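/- Let $p$ be a positive integer and let $n_1,\dots,n_p$ and $k_1,\dots,k_p$ be positive integers with $n_i\ge 2k_i$ for all $i\in[p]$. For $S\subseteq[p]$, let $\prod_{s\in S}\binom{[n_s]}{k_s}$ be the family of all tuples $(A_s)_{s\in S}$ with $A_s\subseteq[n_s]$ and $|A_s|=k_s$, where a tuple is identified with the subset $\bigsqcup_s A_s$ of the disjoint union of the $[n_s]$. Two such sets $A,B$ intersect, written $A\cap B\neq\emptyset$, if $A_s\cap B_s\ne\emptyset$ for at least one $s$; $\bar A$ denotes the tuple of complements $([n_s]\setminus A_s)_s$. A family is intersecting if any two of its members intersect. For $\mathcal D\subseteq\mathcal F$ put $\mathcal D_{\mathcal F}=\{B\in\mathcal F: A\cap B=\emptyset\text{ for some }A\in\mathcal D\}$. The symbol $\sqcup$ between families denotes a union that is required to be disjoint. Let $X=\prod_{i\in[p]}\binom{[n_i]}{k_i}$, let $m\ge 1$, and let $\mathcal A_1,\dots,\mathcal A_m\subseteq X$ be cross-intersecting, i.e. $A\cap B\ne\emptyset$ for all $A\in\mathcal A_i$, $B\in\mathcal A_j$, $i\neq j$. Assume $\mathcal A_1\ne\emptyset$.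 Then $$\sum_{i=1}^m|\mathcal A_i|\le\begin{cases}|X|,&\text{if } m\le\min_{i\in[p]}\frac{n_i}{k_i};\\ m\cdot M,&\text{if } m\ge\min_{i\in[p]}\frac{n_i}{k_i},\end{cases}\qquad M=\max_{i\in[p]}\binom{n_i-1}{k_i-1}\prod_{j\neq i}\binom{n_j}{k_j}.$$ Furthermore, the bound is attained if and only if one of the following holds: (i) $m<\min_i\frac{n_i}{k_i}$, $\mathcal A_1=X$ and $\mathcal A_2=\dots=\mathcal A_m=\emptyset$; (ii) $m>\min_i\frac{n_i}{k_i}$ and $\mathcal A_1=\dots=\mathcal A_m=I$ for some intersecting family $I\subseteq X$ of maximum size; (iii) $m=\min_i\frac{n_i}{k_i}$ and one of the following holds: $\mathcal A_1=X$ and $\mathcal A_2=\dots=\mathcal A_m=\emptyset$; or $\mathcal A_1=\dots=\mathcal A_m=I$ for some intersecting family $I\subseteq X$ of maximum size; or $m=2$ and there are a non-empty set $S_1\subseteq\{s\in[p]:\frac{n_s}{k_s}=2\}$ and families $\mathcal A,\mathcal E,\mathcal E'\subseteq\mathcal F:=\prod_{s\in S_1}\binom{[n_s]}{k_s}$ (possibly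 empty) such that $$\mathcal A_1=\bigl(\mathcal A\sqcup(\mathcal E\cup\mathcal E_{\mathcal F})\bigr)\times\prod_{s\in[p]\setminus S_1}\binom{[n_s]}{k_s},\qquad \mathcal A_2=\bigl(\mathcal A\sqcup(\mathcal E'\cup\mathcal E'_{\mathcal F})\bigr)\times\prod_{s\in[p]\setminus S_1}\binom{[n_s]}{k_s},$$ where $\mathcal A=\{A_1,\dots,A_{w_0}\}$ has $w_0$ members, $2w_0<|\mathcal F|$ and $A_i\ne\bar A_j$ for all $i\ne j$, and where, for some $v$ and some distinct $E_1,\dots,E_v\in\mathcal F$, we have $\mathcal E\sqcup\mathcal E'=\{E_1,\dots,E_v\}$, $\mathcal E_{\mathcal F}\sqcup\mathcal E'_{\mathcal F}=\{\bar E_1,\dots,\bar E_v\}$, $2(v+w_0)=\prod_{s\in S_1}\binom{n_s}{k_s}$, and $\bigsqcup_{j=1}^v\{E_j,\bar E_j\}=\mathcal F\setminus(\mathcal A\sqcup\mathcal A_{\mathcal F})$. -/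

import Mathlib

namespace MultiPart

/-- The multi-part family `∏ i, ([n i] choose k i)`.  A subset of the disjoint union of the parts
`[n i]` is represented by the tuple of its traces on the parts. -/
def layer {ι : Type*} [Fintype ι] [DecidableEq ι] (n k : ι → ℕ) :
    Finset ((i : ι) → Finset (Fin (n i))) :=
  Fintype.piFinset fun i => Finset.powersetCard (k i) Finset.univ

/-- Two multi-part sets meet if they have a common element in at least one part. -/
def Meets {ι : Type*} {n : ι → ℕ} (A B : (i : ι) → Finset (Fin (n i))) : Prop :=
  ∃ i, (A i ∩ B i).Nonempty

instance {ι : Type*} [Fintype ι] {n : ι → ℕ} (A B : (i : ι) → Finset (Fin (n i))) :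
    Decidable (Meets A B) :=
  inferInstanceAs (Decidable (∃ i, (A i ∩ B i).Nonempty))

/-- The complement of a multi-part set. -/
def compl {ι : Type*} {n : ι → ℕ} (A : (i : ι) → Finset (Fin (n i))) :
    (i : ι) → Finset (Fin (n i)) :=
  fun i => (A i)ᶜ

/-- An intersecting family: any two members meet. -/
def Intersecting {ι : Type*} {n : ι → ℕ} (F : Finset ((i : ι) → Finset (Fin (n i)))) : Prop :=
  ∀ A ∈ F, ∀ B ∈ F, Meets A B

/-- `I` is an intersecting subfamily of `X` of the largest possible size. -/
def IsMaximumIntersecting {ι : Type*} {n : ι → ℕ}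
    (X I : Finset ((i : ι) → Finset (Fin (n i)))) : Prop :=
  I ⊆ X ∧ Intersecting I ∧ ∀ J ⊆ X, Intersecting J → J.card ≤ I.card

/-- The families `A 0, …, A (m - 1)` are cross-intersecting families over `X`. -/
def CrossIntersecting {ι : Type*} {n : ι → ℕ} {m : ℕ}
    (X : Finset ((i : ι) → Finset (Fin (n i))))
    (A : Fin m → Finset ((i : ι) → Finset (Fin (n i)))) : Prop :=
  (∀ i, A i ⊆ X) ∧ ∀ i j, i ≠ j → ∀ B ∈ A i, ∀ C ∈ A j, Meets B C

/-- The members of `F` that are disjoint from some member of `D` (written `D_F`). -/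
def nonMeeting {ι : Type*} [Fintype ι] {n : ι → ℕ}
    (F D : Finset ((i : ι) → Finset (Fin (n i)))) : Finset ((i : ι) → Finset (Fin (n i))) :=
  F.filter fun B => ∃ A ∈ D, ¬ Meets A B

/-- `min_i n_i / k_i`. -/
def minRatio {p : ℕ} [NeZero p] (n k : Fin p → ℕ) : ℚ :=
  Finset.univ.inf' Finset.univ_nonempty fun i => (n i : ℚ) / (k i : ℚ)

/-- `M = max_i C(n_i - 1, k_i - 1) * ∏_{j ≠ i} C(n_j, k_j)`. -/
def starMax {p : ℕ} (n k : Fin p → ℕ) : ℕ :=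
  Finset.univ.sup fun i =>
    (n i - 1).choose (k i - 1) * ∏ j ∈ Finset.univ.erase i, (n j).choose (k j)

/-- The family `∏_{s ∈ S} ([n s] choose k s)`. -/
def subLayer {p : ℕ} (n k : Fin p → ℕ) (S : Finset (Fin p)) :
    Finset ((s : S) → Finset (Fin (n s))) :=
  layer (fun s : S => n s) (fun s : S => k s)

/-- `D × ∏_{s ∉ S} ([n s] choose k s)`, for a family `D ⊆ ∏_{s ∈ S} ([n s] choose k s)`. -/
def cylinder {p : ℕ} (n k : Fin p → ℕ) (S : Finset (Fin p))
    (D : Finset ((s : S) → Finset (Fin (n s)))) : Finset ((i : Fin p) → Finset (Fin (n i))) :=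
  (layer n k).filter fun A => (fun s : S => A s) ∈ D

/-- The mixed extremal structure of a pair of families, built from complementary pairs. -/
def IsMixedPair {p : ℕ} (n k : Fin p → ℕ)
    (A₁ A₂ : Finset ((i : Fin p) → Finset (Fin (n i)))) : Prop :=
  ∃ S : Finset (Fin p), S.Nonempty ∧ (∀ s ∈ S, (n s : ℚ) / (k s : ℚ) = 2) ∧
    ∃ (D E E' : Finset ((s : S) → Finset (Fin (n s)))) (v : ℕ)
      (e : Fin v → ((s : S) → Finset (Fin (n s)))),
      D ⊆ subLayer n k S ∧ E ⊆ subLayer n k S ∧ E' ⊆ subLayer n k S ∧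
      -- `D` has fewer than `|F| / 2` members and contains no complementary pair
      2 * D.card < (subLayer n k S).card ∧
      (∀ A ∈ D, ∀ B ∈ D, A ≠ B → A ≠ compl B) ∧
      -- `E ⊔ E' = {e₁, …, e_v}` and `E_F ⊔ E'_F` consists of the complements
      Function.Injective e ∧
      Disjoint E E' ∧ E ∪ E' = Finset.univ.image e ∧
      Disjoint (nonMeeting (subLayer n k S) E) (nonMeeting (subLayer n k S) E') ∧
      nonMeeting (subLayer n k S) E ∪ nonMeeting (subLayer n k S) E' =
        Finset.univ.image (fun j => compl (e j)) ∧
      2 * (v + D.card) = ∏ s ∈ S, (n s).choose (k s) ∧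
      -- the pairs `{e_j, compl e_j}` partition `F \ (D ⊔ D_F)`
      (∀ i j, i ≠ j → Disjoint ({e i, compl (e i)} : Finset _) {e j, compl (e j)}) ∧
      Disjoint D (nonMeeting (subLayer n k S) D) ∧
      Finset.univ.biUnion (fun j => ({e j, compl (e j)} : Finset _)) =
        subLayer n k S \ (D ∪ nonMeeting (subLayer n k S) D) ∧
      -- the two families
      Disjoint D (E ∪ nonMeeting (subLayer n k S) E) ∧
      Disjoint D (E' ∪ nonMeeting (subLayer n k S) E') ∧
      A₁ = cylinder n k S (D ∪ (E ∪ nonMeeting (subLayer n k S) E)) ∧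
      A₂ = cylinder n k S (D ∪ (E' ∪ nonMeeting (subLayer n k S) E'))

/-- One family is everything and all the others are empty. -/
def IsTrivialConfig {p m : ℕ} [NeZero m] (n k : Fin p → ℕ)
    (A : Fin m → Finset ((i : Fin p) → Finset (Fin (n i)))) : Prop :=
  A 0 = layer n k ∧ ∀ i, i ≠ 0 → A i = ∅

/-- All the families are equal to one maximum intersecting family. -/
def IsConstantConfig {p m : ℕ} (n k : Fin p → ℕ)
    (A : Fin m → Finset ((i : Fin p) → Finset (Fin (n i)))) : Prop :=
  ∃ I, IsMaximumIntersecting (layer n k) I ∧ ∀ i, A i = I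

/-- The list of extremal configurations. -/
def IsExtremal {p m : ℕ} [NeZero p] [NeZero m] (n k : Fin p → ℕ)
    (A : Fin m → Finset ((i : Fin p) → Finset (Fin (n i)))) : Prop :=
  ((m : ℚ) < minRatio n k ∧ IsTrivialConfig n k A) ∨
  ((m : ℚ) > minRatio n k ∧ IsConstantConfig n k A) ∨
  ((m : ℚ) = minRatio n k ∧
    (IsTrivialConfig n k A ∨ IsConstantConfig n k A ∨
      ∃ h : 1 < m, IsMixedPair n k (A 0) (A ⟨1, h⟩)))

end MultiPart

/-!
Let `c B` be the number of families containing `B`, so that `∑ |A i|` is the sum of `c` over the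
layer `X`.  Cross-intersection says that if `B` and `C` do not meet and both have `c > 0`, then
`c B = c C = 1` and both lie in the same family.

The proof is a Katona type averaging.  Let `N / K` be a fraction with
`2 ≤ N / K ≤ n i / k i` for all `i`.  Positions on a circle of length `N`, adjacent when their
cyclic distance is at least `K`, map to `X` by stretching the circle onto each `[n i]` and taking
an arc (`cyc`), and adjacent positions go to non-meeting sets (`not_meets_cyc`).  On such a cycle,
if some position has `c ≥ 2`, its neighbours have `c = 0`, and the other positions split into `K`
adjacent pairs of weight at most `m` each (`sum_range_eq_sum_pairs`); otherwise `c ≤ 1` everywhere.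
So the weight of a cycle is at most `max N (m K)`.  Averaging over all tuples of permutations
(`card_mul_sum_cyc`) gives `N ∑ |A i| ≤ |X| max N (m K)` (`mul_sum_card_le`); with `N / K` the
minimal ratio this is the claimed bound, since the largest star has size `M = |X| K / N`
(`mul_starMax`).  For `N` copies of one intersecting family it is the Erdős–Ko–Rado bound, hence
`M` is the maximum size of an intersecting family.

In the case of equality every relabelled cycle is extremal, and every non-meeting pair lies on one
(`exists_relabel_cyc`).  On an extremal cycle either `c = 1` throughout or, for `m ≥ 3`, `c` only
takes the values `0` and `m` (`mult_pair_of_eq`).  If all ratios exceed two, the disjointness graph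
is connected by walks of even length (`of_two_step`), so one alternative holds on all of `X`, and
the families are trivial or constant.  For two families and minimal ratio two, cycles with `N = 2`
and `K = 1` are the non-meeting pairs themselves, and equality says that
`C ∈ A 0 ↔ B ∉ A 1` for all of them (`mem_iff_notMem_of_sum_eq`).  By `of_two_step` both families are
then cylinders over the parts of ratio two, where non-meeting pairs are complementary pairs; sorting
these pairs by how they meet the two families gives the mixed configurations
(`exists_mixed_structure`).
-/

namespace MultiPart

/-! ### Relabelling the ground sets -/

section Relabel

variable {ι : Type*} {n k : ι → ℕ}

/-- The action of a tuple of permutations of the parts on multi-part sets. -/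
def relabel (σ : (i : ι) → Equiv.Perm (Fin (n i))) (A : (i : ι) → Finset (Fin (n i))) :
    (i : ι) → Finset (Fin (n i)) :=
  fun i => (A i).map (σ i).toEmbedding

lemma relabel_mul (σ τ : (i : ι) → Equiv.Perm (Fin (n i))) (A : (i : ι) → Finset (Fin (n i))) :
    relabel (σ * τ) A = relabel σ (relabel τ A) := by
  funext i
  simp only [relabel, Finset.map_map]
  rfl

lemma relabel_one (A : (i : ι) → Finset (Fin (n i))) : relabel 1 A = A := by
  funext i
  exact (A i).map_refl

lemma meets_comm {A B : (i : ι) → Finset (Fin (n i))} : Meets A B ↔ Meets B A := by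
  simp only [Meets, Finset.inter_comm]

lemma not_meets_iff {A B : (i : ι) → Finset (Fin (n i))} :
    ¬ Meets A B ↔ ∀ i, Disjoint (A i) (B i) := by
  simp [Meets, Finset.disjoint_iff_inter_eq_empty]

lemma not_meets_relabel {A B : (i : ι) → Finset (Fin (n i))}
    (σ : (i : ι) → Equiv.Perm (Fin (n i))) (h : ¬ Meets A B) :
    ¬ Meets (relabel σ A) (relabel σ B) := by
  rw [not_meets_iff] at h ⊢
  exact fun i => (Finset.disjoint_map _).2 (h i)

variable [Fintype ι] [DecidableEq ι]

lemma mem_layer {A : (i : ι) → Finset (Fin (n i))} :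
    A ∈ layer n k ↔ ∀ i, (A i).card = k i := by
  simp [layer, Finset.mem_powersetCard]

lemma card_layer (n k : ι → ℕ) : (layer n k).card = ∏ i, (n i).choose (k i) := by
  simp [layer, Fintype.card_piFinset]

lemma relabel_mem_layer {A : (i : ι) → Finset (Fin (n i))}
    (σ : (i : ι) → Equiv.Perm (Fin (n i))) (hA : A ∈ layer n k) : relabel σ A ∈ layer n k := by
  rw [mem_layer] at hA ⊢
  intro i
  rw [relabel, Finset.card_map, hA i]

lemma sum_relabel (σ : (i : ι) → Equiv.Perm (Fin (n i)))
    (f : ((i : ι) → Finset (Fin (n i))) → ℕ) :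
    ∑ A ∈ layer n k, f (relabel σ A) = ∑ A ∈ layer n k, f A := by
  refine Finset.sum_nbij' (relabel σ) (relabel σ⁻¹) (fun A hA => relabel_mem_layer σ hA)
    (fun A hA => relabel_mem_layer σ⁻¹ hA) ?_ ?_ (fun _ _ => rfl)
  · intro A _
    rw [← relabel_mul, inv_mul_cancel, relabel_one]
  · intro A _
    rw [← relabel_mul, mul_inv_cancel, relabel_one]

lemma exists_perm_map_eq {n k : ℕ} {U V U' V' : Finset (Fin n)} (hU : U.card = k)
    (hV : V.card = k) (hU' : U'.card = k) (hV' : V'.card = k) (hd : Disjoint U V)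
    (hd' : Disjoint U' V') :
    ∃ σ : Equiv.Perm (Fin n), U.map σ.toEmbedding = U' ∧ V.map σ.toEmbedding = V' := by
  classical
  -- The two pairs induce colourings of the ground set with equally large colour classes.
  let col (P Q : Finset (Fin n)) (x : Fin n) : Fin 3 := if x ∈ P then 0 else if x ∈ Q then 1 else 2
  have h0 (P Q : Finset (Fin n)) (x) : col P Q x = 0 ↔ x ∈ P := by
    simp only [col]; split_ifs <;> simp_all
  have h1 (P Q : Finset (Fin n)) (hPQ : Disjoint P Q) (x) : col P Q x = 1 ↔ x ∈ Q := by
    have hx : x ∈ P → x ∉ Q := fun h => Finset.disjoint_left.1 hPQ h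
    simp only [col]; split_ifs <;> simp_all
  have h2 (P Q : Finset (Fin n)) (x) : col P Q x = 2 ↔ x ∈ (P ∪ Q)ᶜ := by
    simp only [col]; split_ifs <;> simp_all
  have key : ∀ c, Nonempty ({x // col U V x = c} ≃ {x // col U' V' x = c}) := by
    intro c
    refine ⟨Fintype.equivOfCardEq ?_⟩
    rw [Fintype.card_subtype, Fintype.card_subtype]
    fin_cases c
    · simp [h0, hU, hU']
    · simp [h1 _ _ hd, h1 _ _ hd', hV, hV']
    · simp only [Fin.reduceFinMk, h2, Finset.filter_univ_mem, Finset.card_compl,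
        Finset.card_union_of_disjoint hd, Finset.card_union_of_disjoint hd', hU, hV, hU', hV']
  let σ : Equiv.Perm (Fin n) := Equiv.ofFiberEquiv fun c => (key c).some
  have hσ (x) : col U' V' (σ x) = col U V x := Equiv.ofFiberEquiv_map _ x
  refine ⟨σ, ?_, ?_⟩
  · refine Finset.eq_of_subset_of_card_le ?_ (by simp [hU, hU'])
    intro y hy
    obtain ⟨x, hx, rfl⟩ := Finset.mem_map.1 hy
    exact (h0 U' V' _).1 ((hσ x).trans ((h0 U V x).2 hx))
  · refine Finset.eq_of_subset_of_card_le ?_ (by simp [hV, hV'])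
    intro y hy
    obtain ⟨x, hx, rfl⟩ := Finset.mem_map.1 hy
    exact (h1 U' V' hd' _).1 ((hσ x).trans ((h1 U V hd x).2 hx))

/-- Relabelling is transitive on the ordered pairs of non-meeting members of the layer. -/
lemma exists_relabel_eq {A B A' B' : (i : ι) → Finset (Fin (n i))} (hA : A ∈ layer n k)
    (hB : B ∈ layer n k) (hA' : A' ∈ layer n k) (hB' : B' ∈ layer n k) (h : ¬ Meets A B)
    (h' : ¬ Meets A' B') : ∃ σ, relabel σ A = A' ∧ relabel σ B = B' := by
  rw [mem_layer] at hA hB hA' hB'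
  rw [not_meets_iff] at h h'
  choose σ hσ using fun i =>
    exists_perm_map_eq (hA i) (hB i) (hA' i) (hB' i) (h i) (h' i)
  exact ⟨σ, funext fun i => (hσ i).1, funext fun i => (hσ i).2⟩

/-- A member of the layer that avoids a given tuple of small sets. -/
lemma exists_mem_layer_disjoint (T : (i : ι) → Finset (Fin (n i)))
    (hT : ∀ i, (T i).card + k i ≤ n i) :
    ∃ B ∈ layer n k, ∀ i, Disjoint (T i) (B i) := by
  have (i : ι) : ∃ B ⊆ (T i)ᶜ, B.card = k i := by
    refine Finset.exists_subset_card_eq ?_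
    rw [Finset.card_compl, Fintype.card_fin]
    have := hT i
    omega
  choose B hB hc using this
  exact ⟨B, mem_layer.2 hc, fun i =>
    (Finset.disjoint_left.2 fun x hx hx' => Finset.mem_compl.1 (hB i hx') hx)⟩

lemma exists_not_meets (hnk : ∀ i, 2 * k i ≤ n i) {A : (i : ι) → Finset (Fin (n i))}
    (hA : A ∈ layer n k) : ∃ B ∈ layer n k, ¬ Meets A B := by
  obtain ⟨B, hB, h⟩ := exists_mem_layer_disjoint (k := k) A
    (fun i => by have := hnk i; have := mem_layer.1 hA i; omega)
  exact ⟨B, hB, not_meets_iff.2 h⟩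

/-- Averaging over all relabellings of one member is averaging over the layer. -/
lemma card_mul_sum_relabel (hnk : ∀ i, 2 * k i ≤ n i)
    (f : ((i : ι) → Finset (Fin (n i))) → ℕ)
    {A : (i : ι) → Finset (Fin (n i))} (hA : A ∈ layer n k) :
    (layer n k).card * ∑ σ : (i : ι) → Equiv.Perm (Fin (n i)), f (relabel σ A) =
      Fintype.card ((i : ι) → Equiv.Perm (Fin (n i))) * ∑ B ∈ layer n k, f B := by
  have inv : ∀ B ∈ layer n k,
      ∑ σ : (i : ι) → Equiv.Perm (Fin (n i)), f (relabel σ B) =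
        ∑ σ : (i : ι) → Equiv.Perm (Fin (n i)), f (relabel σ A) := by
    intro B hB
    obtain ⟨A', hA', hAA'⟩ := exists_not_meets hnk hA
    obtain ⟨B', hB', hBB'⟩ := exists_not_meets hnk hB
    obtain ⟨τ, hτ, -⟩ := exists_relabel_eq hA hA' hB hB' hAA' hBB'
    rw [← hτ]
    simp only [← relabel_mul]
    exact Equiv.sum_comp (Equiv.mulRight τ) fun σ => f (relabel σ A)
  rw [← smul_eq_mul, ← Finset.sum_const, ← Finset.sum_congr rfl inv, Finset.sum_comm]
  simp only [sum_relabel, Finset.sum_const, smul_eq_mul, Finset.card_univ]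

end Relabel

/-! ### Connectivity of the disjointness graph -/

section Connectivity

variable {ι : Type*} [Fintype ι] [DecidableEq ι] {n k : ι → ℕ}

/-- If `P` is preserved by walks of length two in the disjointness graph, then membership of `P`
does not depend on the parts with `n i > 2 k i`: exchanging one element in such a part
is a walk of length two. -/
lemma of_two_step (hnk : ∀ i, 2 * k i ≤ n i) {P : ((i : ι) → Finset (Fin (n i))) → Prop}
    (hP : ∀ A ∈ layer n k, ∀ B ∈ layer n k, ∀ C ∈ layer n k,
      ¬ Meets A B → ¬ Meets B C → P A → P C)
    {A Z : (i : ι) → Finset (Fin (n i))} (hA : A ∈ layer n k) (hZ : Z ∈ layer n k)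
    (hAZ : ∀ i, n i = 2 * k i → A i = Z i) (h : P A) : P Z := by
  induction hd : ∑ i, (A i \ Z i).card using Nat.strong_induction_on generalizing A with
  | _ d ih =>
  subst hd
  by_cases hEq : A = Z
  · exact hEq ▸ h
  obtain ⟨i, hi⟩ := Function.ne_iff.1 hEq
  have cA := mem_layer.1 hA
  have cZ := mem_layer.1 hZ
  have hni : 2 * k i < n i := lt_of_le_of_ne (hnk i) fun e => hi (hAZ i e.symm)
  obtain ⟨a, ha⟩ : (A i \ Z i).Nonempty := by
    rw [Finset.sdiff_nonempty]
    exact fun hs => hi (Finset.eq_of_subset_of_card_le hs (by rw [cA, cZ]))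
  obtain ⟨b, hb⟩ : (Z i \ A i).Nonempty := by
    rw [Finset.sdiff_nonempty]
    exact fun hs => hi (Finset.eq_of_subset_of_card_le hs (by rw [cA, cZ])).symm
  rw [Finset.mem_sdiff] at ha hb
  set A' := Function.update A i (insert b ((A i).erase a)) with hA'
  have hA'i : A' i = insert b ((A i).erase a) := by simp [hA']
  have hA'j : ∀ j, j ≠ i → A' j = A j := fun j hj => by simp [hA', hj]
  have hA'L : A' ∈ layer n k := by
    rw [mem_layer]
    intro j
    by_cases hj : j = i
    · subst hj
      rw [hA'i, Finset.card_insert_of_notMem (by simp [hb.2]), Finset.card_erase_add_one ha.1, cA]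
    · rw [hA'j j hj, cA]
  obtain ⟨B, hB, hdis⟩ := exists_mem_layer_disjoint (k := k)
    (Function.update A i (insert b (A i))) (fun j => by
      by_cases hj : j = i
      · subst hj
        rw [Function.update_self, Finset.card_insert_of_notMem hb.2, cA]
        omega
      · rw [Function.update_of_ne hj, cA]
        have := hnk j
        omega)
  have hAB : ¬ Meets A B := by
    rw [not_meets_iff]
    intro j
    by_cases hj : j = i
    · subst hj
      have := hdis j
      rw [Function.update_self] at this
      exact this.mono_left (Finset.subset_insert _ _)
    · have := hdis j
      rwa [Function.update_of_ne hj] at this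
  have hBA' : ¬ Meets B A' := by
    rw [meets_comm, not_meets_iff]
    intro j
    by_cases hj : j = i
    · subst hj
      have := hdis j
      rw [Function.update_self] at this
      rw [hA'i]
      exact this.mono_left (Finset.insert_subset_insert _ (Finset.erase_subset _ _))
    · have := hdis j
      rwa [Function.update_of_ne hj, ← hA'j j hj] at this
  refine ih _ ?_ hA'L ?_ (hP A hA B hB A' hA'L hAB hBA' h) rfl
  · refine Finset.sum_lt_sum (fun j _ => ?_) ⟨i, Finset.mem_univ i, ?_⟩
    · by_cases hj : j = i
      · subst hj
        rw [hA'i, Finset.insert_sdiff_of_mem _ hb.1]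
        exact Finset.card_le_card (Finset.sdiff_subset_sdiff (Finset.erase_subset _ _) le_rfl)
      · rw [hA'j j hj]
    · rw [hA'i, Finset.insert_sdiff_of_mem _ hb.1]
      refine Finset.card_lt_card (Finset.ssubset_iff_subset_ne.2
        ⟨Finset.sdiff_subset_sdiff (Finset.erase_subset _ _) le_rfl, fun e => ?_⟩)
      have : a ∈ (A i).erase a \ Z i := e ▸ Finset.mem_sdiff.2 ha
      simp at this
  · intro j hj
    have hji : j ≠ i := by
      rintro rfl
      omega
    rw [hA'j j hji, hAZ j hj]

end Connectivity

/-! ### Cyclic arcs -/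

section Arcs

/-- The cyclic arc of length `k` in `[n]` that starts at `s` modulo `n`. -/
def arc (n k s : ℕ) : Finset (Fin n) :=
  Finset.univ.filter fun x => ∃ t < k, (s + t) % n = x

lemma card_arc {n k : ℕ} (hn : 0 < n) (hk : k ≤ n) (s : ℕ) : (arc n k s).card = k := by
  have : (arc n k s).card = (Finset.range k).card := by
    refine (Finset.card_bij (fun t _ => (⟨(s + t) % n, Nat.mod_lt _ hn⟩ : Fin n)) ?_ ?_ ?_).symm
    · intro t ht
      simp only [arc, Finset.mem_filter, Finset.mem_univ, true_and]
      exact ⟨t, Finset.mem_range.1 ht, rfl⟩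
    · intro t ht t' ht' h
      rw [Finset.mem_range] at ht ht'
      exact (Nat.ModEq.add_left_cancel' s (Fin.mk.inj h)).eq_of_lt_of_lt (by omega) (by omega)
    · intro x hx
      simp only [arc, Finset.mem_filter, Finset.mem_univ, true_and] at hx
      obtain ⟨t, ht, h⟩ := hx
      exact ⟨t, Finset.mem_range.2 ht, Fin.ext h⟩
  rw [this, Finset.card_range]

lemma arc_add_self (n k s : ℕ) : arc n k (s + n) = arc n k s := by
  simp only [arc, add_right_comm s n, Nat.add_mod_right]

lemma disjoint_arc {n k s s' : ℕ} (h : s + k ≤ s') (h' : s' + k ≤ s + n) :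
    Disjoint (arc n k s) (arc n k s') := by
  rw [Finset.disjoint_left]
  intro x hx hx'
  simp only [arc, Finset.mem_filter, Finset.mem_univ, true_and] at hx hx'
  obtain ⟨t, ht, e⟩ := hx
  obtain ⟨t', ht', e'⟩ := hx'
  have hmod : s + t ≡ s' + t' [MOD n] := e.trans e'.symm
  have := Nat.le_of_dvd (by omega) ((Nat.modEq_iff_dvd' (by omega)).1 hmod)
  omega

variable {ι : Type*}

/-- The `j`-th vertex of a cyclic sequence of period `N` of multi-part sets: in each part, the
circle of length `N` is stretched to the circle `[n i]` and an arc is taken there. -/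
def cyc (n k : ι → ℕ) (N j : ℕ) : (i : ι) → Finset (Fin (n i)) :=
  fun i => arc (n i) (k i) (j * n i / N)

lemma cyc_mem_layer [Fintype ι] [DecidableEq ι] {n k : ι → ℕ} (hk : ∀ i, 0 < k i)
    (hnk : ∀ i, 2 * k i ≤ n i) (N j : ℕ) : cyc n k N j ∈ layer n k :=
  mem_layer.2 fun i => card_arc (by have := hk i; have := hnk i; omega)
    (by have := hnk i; omega) _

lemma cyc_add_self (n k : ι → ℕ) {N : ℕ} (hN : 0 < N) (j : ℕ) :
    cyc n k N (j + N) = cyc n k N j := by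
  funext i
  rw [cyc, cyc, add_mul, Nat.add_mul_div_left _ _ hN, arc_add_self]

/-- The sequence `cyc` is a homomorphism from the circular graph, in which positions at cyclic
distance at least `K` are adjacent, to the disjointness graph, provided that `N / K` is at most
every `n i / k i`. -/
lemma not_meets_cyc {n k : ι → ℕ} {N K : ℕ} (hN : 0 < N) (h : ∀ i, N * k i ≤ K * n i)
    (j d : ℕ) (hd : K ≤ d) (hd' : d + K ≤ N) :
    ¬ Meets (cyc n k N j) (cyc n k N (j + d)) := by
  rw [not_meets_iff]
  intro i
  have hi := h i
  refine disjoint_arc ?_ ?_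
  · rw [← Nat.add_mul_div_left _ _ hN]
    refine Nat.div_le_div_right ?_
    nlinarith [Nat.mul_le_mul_right (n i) hd]
  · rw [← Nat.add_mul_div_left _ _ hN, ← Nat.add_mul_div_left _ _ hN]
    refine Nat.div_le_div_right ?_
    nlinarith [Nat.mul_le_mul_right (n i) hd']

end Arcs

/-! ### Weights on a cycle -/

section Cycle

lemma sum_range_add_of_periodic {N : ℕ} {c : ℕ → ℕ} (hc : ∀ j, c (j + N) = c j) (x : ℕ) :
    ∑ j ∈ Finset.range N, c (x + j) = ∑ j ∈ Finset.range N, c j := by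
  induction x with
  | zero => simp
  | succ x ih =>
    rw [← ih]
    have h1 := Finset.sum_range_succ (fun j => c (x + j)) N
    have h2 := Finset.sum_range_succ' (fun j => c (x + j)) N
    rw [h1, hc] at h2
    simpa [add_assoc, add_comm 1] using h2.symm

/-- On a circle of length `N`, the positions at cyclic distance at least `K` from a position `x` of
weight at least two carry no weight.  What remains lies in the window of the `2K` positions from
`x - K` to `x + K - 1`, which splits into `K` adjacent pairs. -/
lemma sum_range_eq_sum_pairs {N K : ℕ} (hKN : 2 * K ≤ N) {c : ℕ → ℕ}
    (hc : ∀ j, c (j + N) = c j)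
    (hadj : ∀ j d, K ≤ d → d + K ≤ N → 0 < c j → 0 < c (j + d) → c j = 1 ∧ c (j + d) = 1)
    {x : ℕ} (hx : 2 ≤ c x) :
    ∑ j ∈ Finset.range N, c j =
      ∑ t ∈ Finset.range K, (c (x + N - K + t) + c (x + N - K + t + K)) := by
  obtain ⟨r, rfl⟩ := Nat.exists_eq_add_of_le hKN
  rw [← sum_range_add_of_periodic hc (x + (2 * K + r) - K), Finset.sum_range_add, two_mul,
    Finset.sum_range_add, Finset.sum_add_distrib]
  have : ∑ t ∈ Finset.range r, c (x + (K + K + r) - K + (K + K + t)) = 0 := by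
    refine Finset.sum_eq_zero fun t ht => ?_
    rw [Finset.mem_range] at ht
    have e : x + (K + K + r) - K + (K + K + t) = x + (K + t) + (2 * K + r) := by omega
    rw [e, hc]
    by_contra h0
    have := hadj x (K + t) (by omega) (by omega) (by omega) (by omega)
    omega
  rw [this, add_zero]
  congr 1
  exact Finset.sum_congr rfl fun t _ => by congr 1; ring

variable {N K m : ℕ} {c : ℕ → ℕ}

lemma add_le_of_adj (hm : 2 ≤ m) (hcm : ∀ j, c j ≤ m)
    (hadj : ∀ j d, K ≤ d → d + K ≤ N → 0 < c j → 0 < c (j + d) → c j = 1 ∧ c (j + d) = 1)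
    (hKN : 2 * K ≤ N) (j : ℕ) : c j + c (j + K) ≤ m := by
  have := hcm j
  have := hcm (j + K)
  by_cases h : 0 < c j ∧ 0 < c (j + K)
  · have := hadj j K le_rfl (by omega) h.1 h.2
    omega
  · omega

lemma sum_range_le_mul (hKN : 2 * K ≤ N) (hc : ∀ j, c (j + N) = c j) (hcm : ∀ j, c j ≤ m)
    (hadj : ∀ j d, K ≤ d → d + K ≤ N → 0 < c j → 0 < c (j + d) → c j = 1 ∧ c (j + d) = 1)
    {x : ℕ} (hx : 2 ≤ c x) : ∑ j ∈ Finset.range N, c j ≤ m * K := by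
  rw [sum_range_eq_sum_pairs hKN hc hadj hx]
  refine (Finset.sum_le_card_nsmul _ _ m fun t _ =>
    add_le_of_adj (hx.trans (hcm x)) hcm hadj hKN _).trans ?_
  simp [mul_comm]

lemma sum_range_le_max (hKN : 2 * K ≤ N) (hc : ∀ j, c (j + N) = c j) (hcm : ∀ j, c j ≤ m)
    (hadj : ∀ j d, K ≤ d → d + K ≤ N → 0 < c j → 0 < c (j + d) → c j = 1 ∧ c (j + d) = 1) :
    ∑ j ∈ Finset.range N, c j ≤ max N (m * K) := by
  by_cases h : ∃ x, 2 ≤ c x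
  · obtain ⟨x, hx⟩ := h
    exact (sum_range_le_mul hKN hc hcm hadj hx).trans (le_max_right _ _)
  · push Not at h
    refine le_trans ?_ (le_max_left _ _)
    refine (Finset.sum_le_card_nsmul _ _ 1 fun t _ => by have := h t; omega).trans ?_
    simp

/-- In the case of equality, either every position has weight one, or `m K` is the bound, and
then for `m ≥ 3` every position has weight `0` or `m`. -/
lemma eq_one_or_of_sum_range_eq (hK : 0 < K) (hKN : 2 * K ≤ N) (hc : ∀ j, c (j + N) = c j)
    (hcm : ∀ j, c j ≤ m)
    (hadj : ∀ j d, K ≤ d → d + K ≤ N → 0 < c j → 0 < c (j + d) → c j = 1 ∧ c (j + d) = 1)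
    (hsum : ∑ j ∈ Finset.range N, c j = max N (m * K)) :
    (m * K ≤ N ∧ ∀ j, c j = 1) ∨
      (N ≤ m * K ∧ (3 ≤ m → ∀ j, c j = 0 ∨ c j = m)) := by
  have hmod : ∀ j, c (j % N) = c j := fun j => by
    conv_rhs => rw [← Nat.mod_add_div j N]
    generalize j / N = q
    induction q with
    | zero => simp
    | succ q ih => rw [mul_add, mul_one, ← add_assoc, hc, ih]
  by_cases h : ∃ x, 2 ≤ c x
  · obtain ⟨x, hx⟩ := h
    have hle := sum_range_le_mul hKN hc hcm hadj hx
    have hN : N ≤ m * K := by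
      rw [hsum] at hle
      exact (le_max_left _ _).trans hle
    refine Or.inr ⟨hN, fun hm => ?_⟩
    rw [max_eq_right hN] at hsum
    have hpair : ∀ t ∈ Finset.range K, c (x + N - K + t) + c (x + N - K + t + K) = m := by
      refine (Finset.sum_eq_sum_iff_of_le fun t _ =>
        add_le_of_adj (by omega) hcm hadj hKN (x + N - K + t)).1 ?_
      rw [← sum_range_eq_sum_pairs hKN hc hadj hx, hsum]
      simp [mul_comm]
    have hzero : ∀ t ∈ Finset.range K, (c (x + N - K + t) = 0 ∨ c (x + N - K + t) = m) ∧
        (c (x + N - K + t + K) = 0 ∨ c (x + N - K + t + K) = m) := by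
      intro t ht
      have h1 := hpair t ht
      by_cases h0 : 0 < c (x + N - K + t) ∧ 0 < c (x + N - K + t + K)
      · have := hadj _ K le_rfl (by omega) h0.1 h0.2
        omega
      · omega
    intro j
    -- the representative of `j` modulo `N` in the window that starts at `x + N - K`
    obtain ⟨u, hu, hju⟩ : ∃ u < N, c j = c (x + N - K + u) := by
      refine ⟨(j + N * (x + N - K) - (x + N - K)) % N, Nat.mod_lt _ (by omega), ?_⟩
      have hge : x + N - K ≤ N * (x + N - K) := Nat.le_mul_of_pos_left _ (by omega)
      rw [← hmod (x + N - K + _), Nat.add_mod_mod, ← hmod j]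
      congr 1
      rw [Nat.add_sub_cancel' (by omega), Nat.add_mul_mod_self_left]
    rw [hju]
    by_cases h1 : u < K
    · exact (hzero u (Finset.mem_range.2 h1)).1
    by_cases h2 : u < 2 * K
    · have := (hzero (u - K) (Finset.mem_range.2 (by omega))).2
      rwa [show x + N - K + (u - K) + K = x + N - K + u by omega] at this
    · left
      rw [show x + N - K + u = x + (u - K) + N by omega, hc]
      by_contra h0
      have := hadj x (u - K) (by omega) (by omega) (by omega) (by omega)
      omega
  · push Not at h
    have hle : ∀ j ∈ Finset.range N, c j ≤ 1 := fun j _ => by have := h j; omega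
    have hs := Finset.sum_le_sum hle
    simp only [Finset.sum_const, Finset.card_range, smul_eq_mul, mul_one] at hs
    have hN : m * K ≤ N := by
      rw [hsum] at hs
      exact (le_max_right _ _).trans hs
    rw [max_eq_left hN] at hsum
    refine Or.inl ⟨hN, fun j => ?_⟩
    rw [← hmod j]
    exact (Finset.sum_eq_sum_iff_of_le hle).1 (by simpa using hsum) _
      (Finset.mem_range.2 (Nat.mod_lt _ (by omega)))

end Cycle

end MultiPart

namespace MultiPart

/-! ### The bound for cross-intersecting families -/

section Bound

variable {ι : Type*} {n k : ι → ℕ} {m : ℕ} {A : Fin m → Finset ((i : ι) → Finset (Fin (n i)))}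

lemma CrossIntersecting.eq_of_not_meets {X : Finset ((i : ι) → Finset (Fin (n i)))}
    (hA : CrossIntersecting X A) {B C : (i : ι) → Finset (Fin (n i))} (h : ¬ Meets B C)
    {i j : Fin m} (hi : B ∈ A i) (hj : C ∈ A j) : i = j :=
  by_contra fun hij => h (hA.2 i j hij B hi C hj)

variable [Fintype ι]

/-- The number of families that contain the multi-part set `B`. -/
def mult (A : Fin m → Finset ((i : ι) → Finset (Fin (n i))))
    (B : (i : ι) → Finset (Fin (n i))) : ℕ :=
  (Finset.univ.filter fun i => B ∈ A i).card

lemma mult_le (A : Fin m → Finset ((i : ι) → Finset (Fin (n i))))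
    (B : (i : ι) → Finset (Fin (n i))) : mult A B ≤ m :=
  (Finset.card_le_univ _).trans_eq (Fintype.card_fin m)

lemma mult_pos_iff {B : (i : ι) → Finset (Fin (n i))} : 0 < mult A B ↔ ∃ i, B ∈ A i := by
  simp [mult, Finset.card_pos, Finset.Nonempty]

lemma mult_eq_card_iff {B : (i : ι) → Finset (Fin (n i))} : mult A B = m ↔ ∀ i, B ∈ A i := by
  have h : mult A B = Fintype.card (Fin m) ↔ _ := Finset.card_eq_iff_eq_univ _
  rw [Fintype.card_fin] at h
  simp [h, Finset.filter_eq_self]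

lemma eq_of_mult_eq_one {B : (i : ι) → Finset (Fin (n i))} (h : mult A B = 1) {i j : Fin m}
    (hi : B ∈ A i) (hj : B ∈ A j) : i = j :=
  Finset.card_le_one.1 h.le i (by simpa using hi) j (by simpa using hj)

lemma CrossIntersecting.mult_eq_one {X : Finset ((i : ι) → Finset (Fin (n i)))}
    (hA : CrossIntersecting X A) {B C : (i : ι) → Finset (Fin (n i))} (h : ¬ Meets B C)
    (hB : 0 < mult A B) (hC : 0 < mult A C) : mult A B = 1 ∧ mult A C = 1 := by
  obtain ⟨i, hi⟩ := mult_pos_iff.1 hB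
  obtain ⟨j, hj⟩ := mult_pos_iff.1 hC
  have hBi : ∀ l, B ∈ A l → l = j := fun l hl => hA.eq_of_not_meets h hl hj
  have hCj : ∀ l, C ∈ A l → i = l := fun l hl => hA.eq_of_not_meets h hi hl
  constructor
  · exact Finset.card_eq_one.2 ⟨j, by
      ext l
      simpa using ⟨hBi l, fun e => by rw [e, ← hBi i hi]; exact hi⟩⟩
  · exact Finset.card_eq_one.2 ⟨i, by
      ext l
      simpa using ⟨fun hl => (hCj l hl).symm, fun e => by rw [e, hCj j hj]; exact hj⟩⟩

variable [DecidableEq ι]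

lemma sum_mult (hA : ∀ i, A i ⊆ layer n k) :
    ∑ B ∈ layer n k, mult A B = ∑ i, (A i).card := by
  simp only [mult, Finset.card_filter]
  rw [Finset.sum_comm]
  refine Finset.sum_congr rfl fun i _ => ?_
  rw [← Finset.card_filter, Finset.filter_mem_eq_inter, Finset.inter_eq_right.2 (hA i)]

/-- The average over all relabelled cycles of the weight of a cycle is proportional to the
total weight of the layer. -/
lemma card_mul_sum_cyc (hk : ∀ i, 0 < k i) (hnk : ∀ i, 2 * k i ≤ n i) (N : ℕ)
    (f : ((i : ι) → Finset (Fin (n i))) → ℕ) :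
    (layer n k).card * ∑ σ : (i : ι) → Equiv.Perm (Fin (n i)),
        ∑ j ∈ Finset.range N, f (relabel σ (cyc n k N j)) =
      Fintype.card ((i : ι) → Equiv.Perm (Fin (n i))) * (N * ∑ B ∈ layer n k, f B) := by
  rw [Finset.sum_comm, Finset.mul_sum,
    Finset.sum_congr rfl fun j _ => card_mul_sum_relabel hnk f (cyc_mem_layer hk hnk N j)]
  simp only [Finset.sum_const, Finset.card_range, smul_eq_mul]
  ring

variable {N K : ℕ}

lemma mult_cyc_adj (hN : 0 < N) (hr : ∀ i, N * k i ≤ K * n i)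
    (hA : CrossIntersecting (layer n k) A) (σ : (i : ι) → Equiv.Perm (Fin (n i))) (j d : ℕ)
    (hd : K ≤ d) (hd' : d + K ≤ N) (h : 0 < mult A (relabel σ (cyc n k N j)))
    (h' : 0 < mult A (relabel σ (cyc n k N (j + d)))) :
    mult A (relabel σ (cyc n k N j)) = 1 ∧ mult A (relabel σ (cyc n k N (j + d))) = 1 :=
  hA.mult_eq_one (not_meets_relabel σ (not_meets_cyc hN hr j d hd hd')) h h'

lemma sum_mult_cyc_le (hK : 0 < K) (hKN : 2 * K ≤ N) (hr : ∀ i, N * k i ≤ K * n i)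
    (hA : CrossIntersecting (layer n k) A) (σ : (i : ι) → Equiv.Perm (Fin (n i))) :
    ∑ j ∈ Finset.range N, mult A (relabel σ (cyc n k N j)) ≤ max N (m * K) :=
  sum_range_le_max hKN (fun j => by rw [cyc_add_self n k (by omega)]) (fun _ => mult_le _ _)
    (mult_cyc_adj (by omega) hr hA σ)

lemma mul_sum_card_le (hk : ∀ i, 0 < k i) (hnk : ∀ i, 2 * k i ≤ n i) (hK : 0 < K)
    (hKN : 2 * K ≤ N) (hr : ∀ i, N * k i ≤ K * n i) (hA : CrossIntersecting (layer n k) A) :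
    N * ∑ i, (A i).card ≤ (layer n k).card * max N (m * K) := by
  have h := card_mul_sum_cyc hk hnk N (mult A)
  rw [sum_mult hA.1] at h
  have hle := Finset.sum_le_sum fun σ (_ : σ ∈ Finset.univ) => sum_mult_cyc_le hK hKN hr hA σ
  rw [Finset.sum_const, smul_eq_mul, Finset.card_univ] at hle
  refine Nat.le_of_mul_le_mul_left (h.symm.trans_le ?_) (Fintype.card_pos)
  calc _ ≤ (layer n k).card * _ := Nat.mul_le_mul_left _ hle
    _ = _ := by ring

lemma card_layer_pos (hnk : ∀ i, 2 * k i ≤ n i) : 0 < (layer n k).card := by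
  rw [card_layer]
  exact Finset.prod_pos fun i _ => Nat.choose_pos (by have := hnk i; omega)

lemma sum_mult_cyc_eq (hk : ∀ i, 0 < k i) (hnk : ∀ i, 2 * k i ≤ n i) (hK : 0 < K)
    (hKN : 2 * K ≤ N) (hr : ∀ i, N * k i ≤ K * n i) (hA : CrossIntersecting (layer n k) A)
    (heq : N * ∑ i, (A i).card = (layer n k).card * max N (m * K))
    (σ : (i : ι) → Equiv.Perm (Fin (n i))) :
    ∑ j ∈ Finset.range N, mult A (relabel σ (cyc n k N j)) = max N (m * K) := by
  have h := card_mul_sum_cyc hk hnk N (mult A)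
  rw [sum_mult hA.1, heq] at h
  refine (Finset.sum_eq_sum_iff_of_le fun σ (_ : σ ∈ Finset.univ) =>
    sum_mult_cyc_le hK hKN hr hA σ).1 ?_ σ (Finset.mem_univ σ)
  rw [Finset.sum_const, smul_eq_mul, Finset.card_univ]
  refine Nat.eq_of_mul_eq_mul_left (card_layer_pos hnk) (h.trans ?_)
  ring

/-- Any non-meeting pair lies on a relabelled cycle, at distance `K`. -/
lemma exists_relabel_cyc (hk : ∀ i, 0 < k i) (hnk : ∀ i, 2 * k i ≤ n i) (hK : 0 < K)
    (hKN : 2 * K ≤ N) (hr : ∀ i, N * k i ≤ K * n i) {B C : (i : ι) → Finset (Fin (n i))}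
    (hB : B ∈ layer n k) (hC : C ∈ layer n k) (h : ¬ Meets B C) :
    ∃ σ, relabel σ (cyc n k N 0) = B ∧ relabel σ (cyc n k N K) = C := by
  refine exists_relabel_eq (cyc_mem_layer hk hnk N 0) (cyc_mem_layer hk hnk N K) hB hC ?_ h
  have := not_meets_cyc (show 0 < N by omega) hr 0 K le_rfl (by omega)
  rwa [zero_add] at this

/-- In the case of equality, the multiplicities of a non-meeting pair are as they are on
an extremal cycle. -/
lemma mult_pair_of_eq (hk : ∀ i, 0 < k i) (hnk : ∀ i, 2 * k i ≤ n i) (hK : 0 < K)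
    (hKN : 2 * K ≤ N) (hr : ∀ i, N * k i ≤ K * n i) (hA : CrossIntersecting (layer n k) A)
    (heq : N * ∑ i, (A i).card = (layer n k).card * max N (m * K))
    {B C : (i : ι) → Finset (Fin (n i))} (hB : B ∈ layer n k) (hC : C ∈ layer n k)
    (h : ¬ Meets B C) :
    (m * K ≤ N ∧ mult A B = 1 ∧ mult A C = 1) ∨
      (N ≤ m * K ∧ (3 ≤ m → (mult A B = 0 ∨ mult A B = m) ∧ (mult A C = 0 ∨ mult A C = m))) := by
  obtain ⟨σ, rfl, rfl⟩ := exists_relabel_cyc hk hnk hK hKN hr hB hC h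
  have := eq_one_or_of_sum_range_eq (c := fun j => mult A (relabel σ (cyc n k N j))) hK hKN
    (fun j => by rw [cyc_add_self n k (by omega)]) (fun _ => mult_le _ _)
    (mult_cyc_adj (by omega) hr hA σ) (sum_mult_cyc_eq hk hnk hK hKN hr hA heq σ)
  exact this.imp (fun h => ⟨h.1, h.2 _, h.2 _⟩) fun h => ⟨h.1, fun hm => ⟨h.2 hm _, h.2 hm _⟩⟩

/-- The Erdős–Ko–Rado bound for multi-part families. -/
lemma Intersecting.mul_card_le (hk : ∀ i, 0 < k i) (hnk : ∀ i, 2 * k i ≤ n i) (hK : 0 < K)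
    (hKN : 2 * K ≤ N) (hr : ∀ i, N * k i ≤ K * n i) {J : Finset ((i : ι) → Finset (Fin (n i)))}
    (hJX : J ⊆ layer n k) (hJ : Intersecting J) : N * J.card ≤ K * (layer n k).card := by
  have hN : 0 < N := by omega
  -- `N` copies of `J` are enough for the second regime of the bound
  have h := mul_sum_card_le (m := N) (A := fun _ => J) hk hnk hK hKN hr
    ⟨fun _ => hJX, fun _ _ _ B hB C hC => hJ B hB C hC⟩
  rw [max_eq_right (Nat.le_mul_of_pos_right _ hK)] at h
  simp only [Finset.sum_const, Finset.card_univ, Fintype.card_fin, smul_eq_mul] at h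
  refine Nat.le_of_mul_le_mul_left (h.trans_eq ?_) hN
  ring

/-- Among the stars centred in part `i`, one has at least the average size. -/
lemma exists_star (i : ι) (hn : 0 < n i) :
    ∃ J ⊆ layer n k, Intersecting J ∧ k i * (layer n k).card ≤ n i * J.card := by
  have : Nonempty (Fin (n i)) := ⟨⟨0, hn⟩⟩
  obtain ⟨x, -, hx⟩ := Finset.exists_le_of_sum_le (s := (Finset.univ : Finset (Fin (n i))))
    (f := fun _ => k i * (layer n k).card)
    (g := fun x => n i * ((layer n k).filter fun B => x ∈ B i).card) Finset.univ_nonempty (by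
      rw [← Finset.mul_sum Finset.univ (fun x => ((layer n k).filter fun B => x ∈ B i).card)]
      simp only [Finset.card_filter]
      rw [Finset.sum_comm (s := Finset.univ) (t := layer n k)]
      have : ∀ B ∈ layer n k, (∑ x, if x ∈ B i then 1 else 0) = k i := fun B hB => by
        rw [← Finset.card_filter, Finset.filter_univ_mem, mem_layer.1 hB]
      rw [Finset.sum_congr rfl this]
      simp only [Finset.sum_const, Finset.card_univ, Fintype.card_fin, smul_eq_mul]
      exact le_of_eq (by ring))
  refine ⟨_, Finset.filter_subset _ _, fun B hB C hC => ⟨i, x, ?_⟩, hx⟩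
  exact Finset.mem_inter.2 ⟨(Finset.mem_filter.1 hB).2, (Finset.mem_filter.1 hC).2⟩

end Bound

/-! ### Equality in terms of multiplicities -/

section Equality

variable {p : ℕ} {n k : Fin p → ℕ}

lemma exists_minRatio_eq [NeZero p] (hk : ∀ i, 0 < k i) :
    ∃ l, minRatio n k = (n l : ℚ) / k l ∧ ∀ i, n l * k i ≤ k l * n i := by
  obtain ⟨l, -, hl⟩ := Finset.exists_mem_eq_inf' (Finset.univ_nonempty (α := Fin p))
    fun i => (n i : ℚ) / (k i : ℚ)
  refine ⟨l, hl, fun i => ?_⟩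
  have h : minRatio n k ≤ (n i : ℚ) / k i := Finset.inf'_le _ (Finset.mem_univ i)
  rw [minRatio, hl, div_le_div_iff₀ (by exact_mod_cast hk l) (by exact_mod_cast hk i)] at h
  have : n l * k i ≤ n i * k l := by exact_mod_cast h
  rwa [mul_comm (k l)]

lemma star_size_mul (hk : ∀ i, 0 < k i) (hnk : ∀ i, 2 * k i ≤ n i) (i : Fin p) :
    n i * ((n i - 1).choose (k i - 1) * ∏ j ∈ Finset.univ.erase i, (n j).choose (k j)) =
      k i * (layer n k).card := by
  rw [card_layer, ← Finset.mul_prod_erase _ _ (Finset.mem_univ i)]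
  obtain ⟨a, ha⟩ : ∃ a, n i = a + 1 := ⟨n i - 1, by have := hk i; have := hnk i; omega⟩
  obtain ⟨b, hb⟩ : ∃ b, k i = b + 1 := ⟨k i - 1, by have := hk i; omega⟩
  rw [ha, hb, ← mul_assoc, ← mul_assoc, Nat.add_sub_cancel, Nat.add_sub_cancel,
    Nat.add_one_mul_choose_eq, mul_comm (b + 1)]

lemma mul_starMax (hk : ∀ i, 0 < k i) (hnk : ∀ i, 2 * k i ≤ n i) {l : Fin p}
    (hl : ∀ i, n l * k i ≤ k l * n i) : n l * starMax n k = k l * (layer n k).card := by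
  have hpos : ∀ i, 0 < n i := fun i => by have := hk i; have := hnk i; omega
  refine le_antisymm ?_ ?_
  · obtain ⟨i, -, hi⟩ := Finset.exists_mem_eq_sup Finset.univ ⟨l, Finset.mem_univ l⟩
      fun i => (n i - 1).choose (k i - 1) * ∏ j ∈ Finset.univ.erase i, (n j).choose (k j)
    have hi' : starMax n k = _ := hi
    have hs := star_size_mul hk hnk i
    rw [← hi'] at hs
    refine Nat.le_of_mul_le_mul_left ?_ (hpos i)
    calc n i * (n l * starMax n k) = n l * k i * (layer n k).card := by rw [mul_left_comm, hs]; ring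
      _ ≤ k l * n i * (layer n k).card := Nat.mul_le_mul_right _ (hl i)
      _ = _ := by ring
  · rw [← star_size_mul hk hnk l]
    exact Nat.mul_le_mul_left _ (Finset.le_sup (f := fun i => (n i - 1).choose (k i - 1) *
      ∏ j ∈ Finset.univ.erase i, (n j).choose (k j)) (Finset.mem_univ l))

lemma isMaximumIntersecting_iff (hk : ∀ i, 0 < k i) (hnk : ∀ i, 2 * k i ≤ n i) {l : Fin p}
    (hl : ∀ i, n l * k i ≤ k l * n i) {I : Finset ((i : Fin p) → Finset (Fin (n i)))}
    (hI : I ⊆ layer n k) (hint : Intersecting I) :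
    IsMaximumIntersecting (layer n k) I ↔ I.card = starMax n k := by
  have hpos : 0 < n l := by have := hk l; have := hnk l; omega
  have hle : ∀ J ⊆ layer n k, Intersecting J → J.card ≤ starMax n k := fun J hJX hJ => by
    refine Nat.le_of_mul_le_mul_left ?_ hpos
    rw [mul_starMax hk hnk hl]
    exact hJ.mul_card_le hk hnk (hk l) (hnk l) hl hJX
  constructor
  · rintro ⟨-, -, h⟩
    obtain ⟨J, hJX, hJ, hJc⟩ := exists_star (n := n) (k := k) l hpos
    rw [← mul_starMax hk hnk hl] at hJc
    exact le_antisymm (hle I hI hint) ((Nat.le_of_mul_le_mul_left hJc hpos).trans (h J hJX hJ))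
  · exact fun h => ⟨hI, hint, fun J hJX hJ => h ▸ hle J hJX hJ⟩

variable {m : ℕ} {A : Fin m → Finset ((i : Fin p) → Finset (Fin (n i)))}

/-- If every member of the layer lies in exactly one family and the disjointness graph is
connected, then one family is everything. -/
lemma isTrivialConfig_of_mult_eq_one [NeZero m] (hnk : ∀ i, 2 * k i < n i)
    (hA : CrossIntersecting (layer n k) A) (hne : A 0 ≠ ∅)
    (h : ∀ B ∈ layer n k, mult A B = 1) : IsTrivialConfig n k A := by
  obtain ⟨B, hB⟩ := Finset.nonempty_iff_ne_empty.2 hne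
  have step : ∀ C ∈ layer n k, ∀ D ∈ layer n k, ¬ Meets C D → C ∈ A 0 → D ∈ A 0 := by
    intro C _ D hD hCD hC0
    obtain ⟨j, hj⟩ := mult_pos_iff.1 (by rw [h D hD]; exact one_pos)
    rwa [hA.eq_of_not_meets hCD hC0 hj]
  have hall : ∀ C ∈ layer n k, C ∈ A 0 := fun C hC =>
    of_two_step (fun i => (hnk i).le) (P := fun C => C ∈ A 0)
      (fun C hC D hD E hE hCD hDE hC0 => step D hD E hE hDE (step C hC D hD hCD hC0))
      (hA.1 0 hB) hC (fun i hi => absurd hi (hnk i).ne') hB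
  refine ⟨Finset.Subset.antisymm (hA.1 0) hall, fun i hi => ?_⟩
  refine Finset.eq_empty_of_forall_notMem fun C hC => hi ?_
  exact eq_of_mult_eq_one (h C (hA.1 i hC)) hC (hall C (hA.1 i hC))

/-- If every member of the layer lies in all families or in none, then the families agree. -/
lemma isConstantConfig_of_mult (hk : ∀ i, 0 < k i) (hnk : ∀ i, 2 * k i ≤ n i) {l : Fin p}
    (hl : ∀ i, n l * k i ≤ k l * n i) (hA : CrossIntersecting (layer n k) A) (hm : 2 ≤ m)
    (hsum : ∑ i, (A i).card = m * starMax n k)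
    (h : ∀ B ∈ layer n k, mult A B = 0 ∨ mult A B = m) : IsConstantConfig n k A := by
  let a : Fin m := ⟨0, by omega⟩
  let b : Fin m := ⟨1, by omega⟩
  have hab : a ≠ b := by simp [a, b]
  have hall : ∀ i, ∀ B ∈ A i, ∀ j, B ∈ A j := by
    intro i B hB
    have hpos : 0 < mult A B := mult_pos_iff.2 ⟨i, hB⟩
    exact mult_eq_card_iff.1 ((h B (hA.1 i hB)).resolve_left hpos.ne')
  have heq : ∀ i, A i = A a := fun i =>
    Finset.Subset.antisymm (fun B hB => hall i B hB a) fun B hB => hall a B hB i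
  refine ⟨A a, (isMaximumIntersecting_iff hk hnk hl (hA.1 a) ?_).2 ?_, heq⟩
  · exact fun B hB C hC => hA.2 a b hab B hB C (hall a C hC b)
  · simp only [heq, Finset.sum_const, Finset.card_univ, Fintype.card_fin, smul_eq_mul] at hsum
    exact Nat.eq_of_mul_eq_mul_left (by omega) hsum

lemma IsConstantConfig.sum_card (hk : ∀ i, 0 < k i) (hnk : ∀ i, 2 * k i ≤ n i) {l : Fin p}
    (hl : ∀ i, n l * k i ≤ k l * n i) (h : IsConstantConfig n k A) :
    ∑ i, (A i).card = m * starMax n k := by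
  obtain ⟨I, hI, hAI⟩ := h
  have := (isMaximumIntersecting_iff hk hnk hl hI.1 hI.2.1).1 hI
  simp [hAI, this]

lemma IsTrivialConfig.sum_card [NeZero m] (h : IsTrivialConfig n k A) :
    ∑ i, (A i).card = (layer n k).card := by
  rw [Finset.sum_eq_single 0 (fun i _ hi => by simp [h.2 i hi]) (by simp), h.1]

end Equality

end MultiPart

namespace MultiPart

/-! ### Complementary pairs -/

section Complement

variable {ι : Type*} {n k : ι → ℕ}

lemma compl_compl (A : (i : ι) → Finset (Fin (n i))) : compl (compl A) = A := by
  funext i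
  simp [compl]

lemma compl_injective : Function.Injective (compl : ((i : ι) → Finset (Fin (n i))) → _) :=
  Function.LeftInverse.injective compl_compl

variable [Fintype ι]

lemma mem_image_compl {A : (i : ι) → Finset (Fin (n i))}
    {G : Finset ((i : ι) → Finset (Fin (n i)))} : A ∈ G.image compl ↔ compl A ∈ G := by
  rw [Finset.mem_image]
  exact ⟨fun ⟨B, hB, h⟩ => by rwa [← h, compl_compl], fun h => ⟨_, h, compl_compl A⟩⟩

variable [DecidableEq ι]

lemma compl_mem_layer (hn : ∀ i, n i = 2 * k i) {A : (i : ι) → Finset (Fin (n i))} :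
    compl A ∈ layer n k ↔ A ∈ layer n k := by
  have key : ∀ {B : (i : ι) → Finset (Fin (n i))}, B ∈ layer n k → compl B ∈ layer n k := by
    intro B hB
    rw [mem_layer] at hB ⊢
    intro i
    have := hn i
    rw [compl, Finset.card_compl, hB, Fintype.card_fin]
    omega
  exact ⟨fun h => compl_compl A ▸ key h, key⟩

lemma eq_compl_of_disjoint {a b : ℕ} (h : a = 2 * b) {U V : Finset (Fin a)} (hU : U.card = b)
    (hV : V.card = b) (hd : Disjoint U V) : V = Uᶜ := by
  refine Finset.eq_of_subset_of_card_le ?_ ?_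
  · exact fun x hx => Finset.mem_compl.2 fun hx' => Finset.disjoint_left.1 hd hx' hx
  · rw [Finset.card_compl, hU, hV, Fintype.card_fin]
    omega

lemma not_meets_iff_eq_compl (hn : ∀ i, n i = 2 * k i) {A B : (i : ι) → Finset (Fin (n i))}
    (hA : A ∈ layer n k) (hB : B ∈ layer n k) : ¬ Meets A B ↔ B = compl A := by
  rw [not_meets_iff]
  constructor
  · exact fun h => funext fun i =>
      eq_compl_of_disjoint (hn i) (mem_layer.1 hA i) (mem_layer.1 hB i) (h i)
  · rintro rfl i
    exact disjoint_compl_right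

lemma mem_nonMeeting (hn : ∀ i, n i = 2 * k i) {G : Finset ((i : ι) → Finset (Fin (n i)))}
    (hG : G ⊆ layer n k) {B : (i : ι) → Finset (Fin (n i))} :
    B ∈ nonMeeting (layer n k) G ↔ compl B ∈ G := by
  rw [nonMeeting, Finset.mem_filter]
  constructor
  · rintro ⟨hB, A, hA, h⟩
    rwa [(not_meets_iff_eq_compl hn (hG hA) hB).1 h, compl_compl]
  · intro h
    have hB := (compl_mem_layer hn).1 (hG h)
    exact ⟨hB, _, h, (not_meets_iff_eq_compl hn (hG h) hB).2 (compl_compl B).symm⟩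

lemma nonMeeting_eq_image_compl (hn : ∀ i, n i = 2 * k i)
    {G : Finset ((i : ι) → Finset (Fin (n i)))} (hG : G ⊆ layer n k) :
    nonMeeting (layer n k) G = G.image compl := by
  ext B
  rw [mem_nonMeeting hn hG, mem_image_compl]

/-- Let `q` and `r` be properties of the members of a layer of ratio two which are exchanged by
complementation up to negation.  Then every complementary pair contributes one set to both
properties or both sets to one property, and if `q` and `r` differ, this is the structure
of a mixed pair. -/
lemma exists_mixed_structure (hn : ∀ i, n i = 2 * k i) (hk : ∀ i, 0 < k i) (l : ι)
    {q r : ((i : ι) → Finset (Fin (n i))) → Prop}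
    (law : ∀ f ∈ layer n k, (q (compl f) ↔ ¬ r f) ∧ (r (compl f) ↔ ¬ q f))
    (hne : ∃ f ∈ layer n k, ¬ (q f ↔ r f)) :
    ∃ (D E E' : Finset ((i : ι) → Finset (Fin (n i)))) (v : ℕ)
      (e : Fin v → ((i : ι) → Finset (Fin (n i)))),
      D ⊆ layer n k ∧ E ⊆ layer n k ∧ E' ⊆ layer n k ∧
      2 * D.card < (layer n k).card ∧
      (∀ A ∈ D, ∀ B ∈ D, A ≠ B → A ≠ compl B) ∧
      Function.Injective e ∧
      Disjoint E E' ∧ E ∪ E' = Finset.univ.image e ∧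
      Disjoint (nonMeeting (layer n k) E) (nonMeeting (layer n k) E') ∧
      nonMeeting (layer n k) E ∪ nonMeeting (layer n k) E' =
        Finset.univ.image (fun j => compl (e j)) ∧
      2 * (v + D.card) = (layer n k).card ∧
      (∀ i j, i ≠ j → Disjoint ({e i, compl (e i)} : Finset _) {e j, compl (e j)}) ∧
      Disjoint D (nonMeeting (layer n k) D) ∧
      Finset.univ.biUnion (fun j => ({e j, compl (e j)} : Finset _)) =
        layer n k \ (D ∪ nonMeeting (layer n k) D) ∧
      Disjoint D (E ∪ nonMeeting (layer n k) E) ∧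
      Disjoint D (E' ∪ nonMeeting (layer n k) E') ∧
      (∀ f ∈ layer n k, f ∈ D ∪ (E ∪ nonMeeting (layer n k) E) ↔ q f) ∧
      (∀ f ∈ layer n k, f ∈ D ∪ (E' ∪ nonMeeting (layer n k) E') ↔ r f) := by
  classical
  have cF : ∀ {f}, compl f ∈ layer n k ↔ f ∈ layer n k := compl_mem_layer hn
  -- containing a fixed point of one part selects one set from each complementary pair
  obtain ⟨s, hs⟩ : ∃ s : ((i : ι) → Finset (Fin (n i))) → Prop, ∀ f, s (compl f) ↔ ¬ s f :=
    ⟨fun f => ⟨0, by have := hk l; have := hn l; omega⟩ ∈ f l, fun f => Finset.mem_compl⟩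
  obtain ⟨D, mD⟩ : ∃ D, ∀ f, f ∈ D ↔ f ∈ layer n k ∧ q f ∧ r f :=
    ⟨_, fun _ => Finset.mem_filter⟩
  obtain ⟨E, mE⟩ : ∃ E, ∀ f, f ∈ E ↔ f ∈ layer n k ∧ q f ∧ ¬ r f ∧ s f :=
    ⟨_, fun _ => Finset.mem_filter⟩
  obtain ⟨E', mE'⟩ : ∃ E', ∀ f, f ∈ E' ↔ f ∈ layer n k ∧ ¬ q f ∧ r f ∧ s f :=
    ⟨_, fun _ => Finset.mem_filter⟩
  have sD : D ⊆ layer n k := fun f hf => ((mD f).1 hf).1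
  have sE : E ⊆ layer n k := fun f hf => ((mE f).1 hf).1
  have sE' : E' ⊆ layer n k := fun f hf => ((mE' f).1 hf).1
  have mDF : ∀ f, f ∈ nonMeeting (layer n k) D ↔ f ∈ layer n k ∧ ¬ q f ∧ ¬ r f := fun f => by
    rw [mem_nonMeeting hn sD, mD, cF]
    have := law f
    grind only
  have mEF : ∀ f, f ∈ nonMeeting (layer n k) E ↔ f ∈ layer n k ∧ q f ∧ ¬ r f ∧ ¬ s f :=
    fun f => by
      rw [mem_nonMeeting hn sE, mE, cF, hs]
      have := law f
      grind only
  have mEF' : ∀ f, f ∈ nonMeeting (layer n k) E' ↔ f ∈ layer n k ∧ ¬ q f ∧ r f ∧ ¬ s f :=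
    fun f => by
      rw [mem_nonMeeting hn sE', mE', cF, hs]
      have := law f
      grind only
  obtain ⟨v, e, he, heG⟩ : ∃ (v : ℕ) (e : Fin v → ((i : ι) → Finset (Fin (n i)))),
      Function.Injective e ∧ E ∪ E' = Finset.univ.image e := by
    refine ⟨(E ∪ E').card, fun j => (E ∪ E').equivFin.symm j,
      Subtype.val_injective.comp (E ∪ E').equivFin.symm.injective, ?_⟩
    ext f
    simp only [Finset.mem_image, Finset.mem_univ, true_and]
    exact ⟨fun hf => ⟨(E ∪ E').equivFin ⟨f, hf⟩, by simp⟩, fun ⟨j, hj⟩ => hj ▸ Subtype.prop _⟩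
  have hv : (E ∪ E').card = v := by
    rw [heG, Finset.card_image_of_injective _ he, Finset.card_univ, Fintype.card_fin]
  have hes : ∀ j, s (e j) := fun j => by
    have h : e j ∈ E ∪ E' := heG ▸ Finset.mem_image_of_mem e (Finset.mem_univ j)
    rw [Finset.mem_union, mE, mE'] at h
    grind only
  have hnecompl : ∀ i j, e i ≠ compl (e j) := fun i j h =>
    (hs (e j)).1 (h ▸ hes i) (hes j)
  have hcompl : nonMeeting (layer n k) E ∪ nonMeeting (layer n k) E' =
      Finset.univ.image fun j => compl (e j) := by
    rw [nonMeeting_eq_image_compl hn sE, nonMeeting_eq_image_compl hn sE', ← Finset.image_union,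
      heG, Finset.image_image]
    rfl
  have hcard : 2 * (v + D.card) = (layer n k).card := by
    have hdis : Disjoint (E ∪ E') D := Finset.disjoint_left.2 fun f hf hf' => by
      rw [Finset.mem_union, mE, mE'] at hf
      rw [mD] at hf'
      grind only
    have him : ∀ f, f ∈ ((E ∪ E') ∪ D).image compl ↔ f ∈ layer n k ∧
        (q f ∧ ¬ r f ∧ ¬ s f ∨ ¬ q f ∧ r f ∧ ¬ s f ∨ ¬ q f ∧ ¬ r f) := fun f => by
      rw [mem_image_compl, Finset.mem_union, Finset.mem_union, ← mem_nonMeeting hn sE,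
        ← mem_nonMeeting hn sE', ← mem_nonMeeting hn sD, mEF, mEF', mDF]
      grind only
    have hF : layer n k = ((E ∪ E') ∪ D) ∪ ((E ∪ E') ∪ D).image compl := by
      ext f
      rw [Finset.mem_union, him, Finset.mem_union, Finset.mem_union, mE, mE', mD]
      grind only
    rw [hF, Finset.card_union_of_disjoint, Finset.card_image_of_injective _ compl_injective,
      Finset.card_union_of_disjoint hdis, hv, two_mul]
    refine Finset.disjoint_left.2 fun f hf hf' => ?_
    rw [him] at hf'
    rw [Finset.mem_union, Finset.mem_union, mE, mE', mD] at hf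
    grind only
  have hpos : 0 < v := by
    obtain ⟨f, hf, hqr⟩ := hne
    have hq := law f hf
    rw [← hv, Finset.card_pos]
    by_cases hx : s f
    · exact ⟨f, by rw [Finset.mem_union, mE, mE']; grind only⟩
    · exact ⟨compl f, by rw [Finset.mem_union, mE, mE', hs, cF]; grind only⟩
  refine ⟨D, E, E', v, e, sD, sE, sE', by omega, ?_, he, ?_, heG, ?_, hcompl, hcard, ?_, ?_, ?_,
    ?_, ?_, ?_, ?_⟩
  · intro f hf g hg _ hfg
    have hq := law g (sD hg)
    rw [← hfg] at hq
    rw [mD] at hf hg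
    grind only
  · refine Finset.disjoint_left.2 fun f hf hf' => ?_
    rw [mE] at hf
    rw [mE'] at hf'
    grind only
  · refine Finset.disjoint_left.2 fun f hf hf' => ?_
    rw [mEF] at hf
    rw [mEF'] at hf'
    grind only
  · intro i j hij
    have h1 := he.ne hij
    have h2 := compl_injective.ne h1
    have h3 := hnecompl i j
    have h4 := (hnecompl j i).symm
    simp [h1.symm, h2.symm, h3.symm, h4.symm]
  · refine Finset.disjoint_left.2 fun f hf hf' => ?_
    rw [mDF] at hf'
    rw [mD] at hf
    grind only
  · have : Finset.univ.biUnion (fun j => ({e j, compl (e j)} : Finset _)) =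
        (E ∪ E') ∪ (nonMeeting (layer n k) E ∪ nonMeeting (layer n k) E') := by
      rw [hcompl, heG]
      ext f
      simp only [Finset.mem_biUnion, Finset.mem_univ, true_and, Finset.mem_insert,
        Finset.mem_singleton, Finset.mem_union, Finset.mem_image, exists_or, eq_comm]
    rw [this]
    ext f
    simp only [Finset.mem_union, Finset.mem_sdiff]
    rw [mE, mE', mEF, mEF', mD, mDF]
    grind only
  · refine Finset.disjoint_left.2 fun f hf hf' => ?_
    rw [Finset.mem_union, mE, mEF] at hf'
    rw [mD] at hf
    grind only
  · refine Finset.disjoint_left.2 fun f hf hf' => ?_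
    rw [Finset.mem_union, mE', mEF'] at hf'
    rw [mD] at hf
    grind only
  · intro f hf
    rw [Finset.mem_union, Finset.mem_union, mD, mE, mEF]
    grind only
  · intro f hf
    rw [Finset.mem_union, Finset.mem_union, mD, mE', mEF']
    grind only

end Complement

/-! ### Pairs of families for ratio two -/

section MixedPair

variable {p : ℕ} {n k : Fin p → ℕ}

lemma mem_cylinder {S : Finset (Fin p)} {D : Finset ((s : S) → Finset (Fin (n s)))}
    {B : (i : Fin p) → Finset (Fin (n i))} :
    B ∈ cylinder n k S D ↔ B ∈ layer n k ∧ (fun s : S => B s) ∈ D := by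
  simp [cylinder]

lemma restrict_mem_subLayer {B : (i : Fin p) → Finset (Fin (n i))} (hB : B ∈ layer n k)
    (S : Finset (Fin p)) : (fun s : S => B s) ∈ subLayer n k S :=
  mem_layer.2 fun s => mem_layer.1 hB s

lemma exists_restrict_eq (hnk : ∀ i, 2 * k i ≤ n i) {S : Finset (Fin p)}
    {f : (s : S) → Finset (Fin (n s))} (hf : f ∈ subLayer n k S) :
    ∃ B ∈ layer n k, (fun s : S => B s) = f := by
  obtain ⟨Z, hZ, -⟩ := exists_mem_layer_disjoint (n := n) (k := k) (fun _ => ∅)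
    (fun i => by have := hnk i; simp; omega)
  refine ⟨fun i => if h : i ∈ S then f ⟨i, h⟩ else Z i, ?_, ?_⟩
  · rw [mem_layer] at hZ ⊢
    intro i
    by_cases h : i ∈ S
    · simp only [h, dite_true]
      exact mem_layer.1 hf ⟨i, h⟩
    · simp only [h, dite_false, hZ]
  · funext s
    simp

lemma card_cylinder {S : Finset (Fin p)} {D : Finset ((s : S) → Finset (Fin (n s)))}
    (hD : D ⊆ subLayer n k S) :
    (cylinder n k S D).card =
      D.card * ∏ i, (if i ∈ S then 1 else (n i).choose (k i)) := by
  rw [Finset.card_eq_sum_card_fiberwise (f := fun B (s : S) => B s) (t := D)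
    (fun B hB => (mem_cylinder.1 hB).2), ← smul_eq_mul, ← Finset.sum_const]
  refine Finset.sum_congr rfl fun f hf => ?_
  have : (cylinder n k S D).filter (fun B => (fun s : S => B s) = f) =
      Fintype.piFinset fun i =>
        if h : i ∈ S then ({f ⟨i, h⟩} : Finset (Finset (Fin (n i)))) else Finset.powersetCard (k i) Finset.univ := by
    ext B
    rw [Finset.mem_filter, mem_cylinder, Fintype.mem_piFinset]
    constructor
    · rintro ⟨⟨hB, -⟩, rfl⟩ i
      by_cases h : i ∈ S
      · simp [h]
      · simp [h, Finset.mem_powersetCard, mem_layer.1 hB i]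
    · intro h
      have hBf : (fun s : S => B s) = f := by
        funext s
        have := h s
        simpa using this
      refine ⟨⟨mem_layer.2 fun i => ?_, hBf ▸ hf⟩, hBf⟩
      by_cases hi : i ∈ S
      · rw [← mem_layer.1 (hD hf) ⟨i, hi⟩, ← hBf]
      · have := h i
        simpa [hi, Finset.mem_powersetCard] using this
  rw [this, Fintype.card_piFinset]
  refine Finset.prod_congr rfl fun i _ => ?_
  by_cases h : i ∈ S <;> simp [h]

lemma card_layer_eq_mul (n k : Fin p → ℕ) (S : Finset (Fin p)) :
    (layer n k).card =
      (subLayer n k S).card * ∏ i, (if i ∈ S then 1 else (n i).choose (k i)) := by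
  rw [← card_cylinder Finset.Subset.rfl]
  congr 1
  ext B
  rw [mem_cylinder]
  exact ⟨fun h => ⟨h, restrict_mem_subLayer h S⟩, fun h => h.1⟩

lemma eq_two_mul_of_div_eq (hk : ∀ i, 0 < k i) {i : Fin p} (h : (n i : ℚ) / k i = 2) :
    n i = 2 * k i := by
  rw [div_eq_iff (by exact_mod_cast (hk i).ne')] at h
  exact_mod_cast h

lemma card_subLayer (n k : Fin p → ℕ) (S : Finset (Fin p)) :
    (subLayer n k S).card = ∏ s ∈ S, (n s).choose (k s) := by
  rw [subLayer, card_layer, Finset.prod_coe_sort S fun s => (n s).choose (k s)]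

lemma IsMixedPair.card_add_card (hk : ∀ i, 0 < k i)
    {A₁ A₂ : Finset ((i : Fin p) → Finset (Fin (n i)))} (h : IsMixedPair n k A₁ A₂) :
    A₁.card + A₂.card = (layer n k).card := by
  obtain ⟨S, ⟨s₀, hs₀⟩, hS, D, E, E', v, e, hD, hE, hE', -, -, he, hEE', hEe, -, -, hcard, hdisj,
    -, -, hDE, hDE', rfl, rfl⟩ := h
  have hn : ∀ s : S, n s = 2 * k s := fun s => eq_two_mul_of_div_eq hk (hS s s.2)
  rw [← card_subLayer] at hcard
  have hne : ∀ f g, f ∈ E ∪ E' → g ∈ E ∪ E' → f ≠ compl g := by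
    intro f g hf hg hfg
    rw [hEe, Finset.mem_image] at hf hg
    obtain ⟨i, -, rfl⟩ := hf
    obtain ⟨j, -, rfl⟩ := hg
    by_cases hij : i = j
    · subst hij
      have h0 := congrFun hfg ⟨s₀, hs₀⟩
      have : Nonempty (Fin (n s₀)) := ⟨⟨0, by have := hk s₀; have := hn ⟨s₀, hs₀⟩; grind⟩⟩
      exact ne_compl_self h0
    · refine Finset.disjoint_left.1 (hdisj i j hij) (Finset.mem_insert_self _ _) ?_
      simp [hfg]
  have half : ∀ G ⊆ E ∪ E', G ⊆ subLayer n k S → Disjoint D (G ∪ nonMeeting (subLayer n k S) G) →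
      D ∪ (G ∪ nonMeeting (subLayer n k S) G) ⊆ subLayer n k S ∧
      (D ∪ (G ∪ nonMeeting (subLayer n k S) G)).card = D.card + 2 * G.card := by
    intro G hG hGF hDG
    refine ⟨Finset.union_subset hD (Finset.union_subset hGF (Finset.filter_subset _ _)), ?_⟩
    rw [Finset.card_union_of_disjoint hDG, Finset.card_union_of_disjoint, subLayer,
      nonMeeting_eq_image_compl hn hGF, Finset.card_image_of_injective _ compl_injective, two_mul]
    rw [subLayer, nonMeeting_eq_image_compl hn hGF, Finset.disjoint_left]
    intro f hf hf'
    exact hne f (compl f) (hG hf) (hG (mem_image_compl.1 hf')) (compl_compl f).symm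
  obtain ⟨h1, h2⟩ := half E Finset.subset_union_left hE hDE
  obtain ⟨h1', h2'⟩ := half E' Finset.subset_union_right hE' hDE'
  have hv : E.card + E'.card = v := by
    rw [← Finset.card_union_of_disjoint hEE', hEe, Finset.card_image_of_injective _ he]
    simp
  rw [card_cylinder h1, card_cylinder h1', ← add_mul, card_layer_eq_mul n k S, h2, h2', ← hcard,
    ← hv]
  ring

/-- If non-membership in one family is passed to membership in the other one along every
non-meeting pair, then both families are cylinders over the parts with `n i = 2 k i`. -/
lemma isMixedPair_of_law (hk : ∀ i, 0 < k i) (hnk : ∀ i, 2 * k i ≤ n i) {l : Fin p}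
    (hl : n l = 2 * k l) {A₁ A₂ : Finset ((i : Fin p) → Finset (Fin (n i)))}
    (hA₁ : A₁ ⊆ layer n k) (hA₂ : A₂ ⊆ layer n k) (hne : A₁ ≠ A₂)
    (law : ∀ B ∈ layer n k, ∀ C ∈ layer n k, ¬ Meets B C →
      (C ∈ A₁ ↔ B ∉ A₂) ∧ (C ∈ A₂ ↔ B ∉ A₁)) : IsMixedPair n k A₁ A₂ := by
  classical
  let S : Finset (Fin p) := Finset.univ.filter fun i => n i = 2 * k i
  have memS : ∀ {i}, i ∈ S ↔ n i = 2 * k i := by simp [S]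
  have hn : ∀ s : S, n s = 2 * k s := fun s => memS.1 s.2
  let F := subLayer n k S
  let q (G : Finset ((i : Fin p) → Finset (Fin (n i)))) (f : (s : S) → Finset (Fin (n s))) : Prop :=
    ∃ B ∈ G, (fun s : S => B s) = f
  -- membership only depends on the parts in `S`
  have inv : ∀ G, G = A₁ ∨ G = A₂ → ∀ B ∈ layer n k, (B ∈ G ↔ q G fun s : S => B s) := by
    intro G hG B hB
    refine ⟨fun h => ⟨B, h, rfl⟩, fun ⟨C, hC, hCB⟩ => ?_⟩
    have hCX : C ∈ layer n k := by
      rcases hG with rfl | rfl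
      · exact hA₁ hC
      · exact hA₂ hC
    refine of_two_step hnk (P := fun C => C ∈ G) ?_ hCX hB
      (fun i hi => congrFun hCB ⟨i, memS.2 hi⟩) hC
    intro C₁ h₁ C₂ h₂ C₃ h₃ h₁₂ h₂₃
    have l₁ := law C₁ h₁ C₂ h₂ h₁₂
    have l₂ := law C₂ h₂ C₃ h₃ h₂₃
    rcases hG with rfl | rfl <;> tauto
  have inv₁ := inv A₁ (Or.inl rfl)
  have inv₂ := inv A₂ (Or.inr rfl)
  have qlaw : ∀ f ∈ F, (q A₁ (compl f) ↔ ¬ q A₂ f) ∧ (q A₂ (compl f) ↔ ¬ q A₁ f) := by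
    intro f hf
    obtain ⟨B, hB, rfl⟩ := exists_restrict_eq hnk hf
    obtain ⟨C, hC, hBC⟩ := exists_not_meets hnk hB
    have hCc : (fun s : S => C s) = compl fun s : S => B s := funext fun s =>
      eq_compl_of_disjoint (hn s) (mem_layer.1 hB s) (mem_layer.1 hC s) (not_meets_iff.1 hBC s)
    rw [← hCc, ← inv₁ C hC, ← inv₂ C hC, ← inv₁ B hB, ← inv₂ B hB]
    exact law B hB C hC hBC
  have hqne : ∃ f ∈ F, ¬ (q A₁ f ↔ q A₂ f) := by
    obtain ⟨B, hB, hBq⟩ : ∃ B ∈ layer n k, ¬ (B ∈ A₁ ↔ B ∈ A₂) := by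
      by_contra! h
      exact hne (Finset.ext fun B =>
        ⟨fun hB => (h B (hA₁ hB)).1 hB, fun hB => (h B (hA₂ hB)).2 hB⟩)
    exact ⟨_, restrict_mem_subLayer hB S, by rwa [← inv₁ B hB, ← inv₂ B hB]⟩
  obtain ⟨D, E, E', v, e, hD, hE, hE', hlt, hDc, he, hEE', hEe, hEF, hEFe, hcard, hpair, hDF,
    hun, hDE, hDE', h₁, h₂⟩ := exists_mixed_structure hn (fun s => hk s) ⟨l, memS.2 hl⟩ qlaw hqne
  refine ⟨S, ⟨l, memS.2 hl⟩, fun s hs => ?_, D, E, E', v, e, hD, hE, hE', hlt, hDc, he, hEE', hEe,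
    hEF, hEFe, hcard.trans (card_subLayer n k S), hpair, hDF, hun, hDE, hDE', ?_, ?_⟩
  · rw [div_eq_iff (by exact_mod_cast (hk s).ne')]
    exact_mod_cast memS.1 hs
  · ext B
    rw [mem_cylinder]
    exact ⟨fun hB => ⟨hA₁ hB, (h₁ _ (restrict_mem_subLayer (hA₁ hB) S)).2 ((inv₁ B (hA₁ hB)).1 hB)⟩,
      fun ⟨hB, h⟩ => (inv₁ B hB).2 ((h₁ _ (restrict_mem_subLayer hB S)).1 h)⟩
  · ext B
    rw [mem_cylinder]
    exact ⟨fun hB => ⟨hA₂ hB, (h₂ _ (restrict_mem_subLayer (hA₂ hB) S)).2 ((inv₂ B (hA₂ hB)).1 hB)⟩,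
      fun ⟨hB, h⟩ => (inv₂ B hB).2 ((h₂ _ (restrict_mem_subLayer hB S)).1 h)⟩

end MixedPair

end MultiPart

namespace MultiPart

/-! ### The extremal configurations -/

section Extremal

variable {p : ℕ} {n k : Fin p → ℕ}

lemma two_mul_lt_of_ratio {a b N K : ℕ} (hb : 0 < b) (h : N * b ≤ K * a) (hKN : 2 * K < N) :
    2 * b < a := by
  by_contra! hab
  have h1 := Nat.mul_lt_mul_of_pos_right hKN hb
  have h2 := Nat.mul_le_mul_left K hab
  have h3 : K * (2 * b) = 2 * K * b := by ring
  omega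

/-- For two families and ratio two, equality in the bound turns every non-meeting pair into a
rule that determines one family from the other. -/
lemma mem_iff_notMem_of_sum_eq {A : Fin 2 → Finset ((i : Fin p) → Finset (Fin (n i)))}
    (hk : ∀ i, 0 < k i) (hnk : ∀ i, 2 * k i ≤ n i) (hA : CrossIntersecting (layer n k) A)
    (hsum : ∑ i, (A i).card = (layer n k).card) {B C : (i : Fin p) → Finset (Fin (n i))}
    (hB : B ∈ layer n k) (hC : C ∈ layer n k) (h : ¬ Meets B C) :
    (C ∈ A 0 ↔ B ∉ A 1) ∧ (C ∈ A 1 ↔ B ∉ A 0) := by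
  -- a non-meeting pair is a cycle with parameters `N = 2` and `K = 1`
  have hr : ∀ i, 2 * k i ≤ 1 * n i := fun i => by simpa using hnk i
  obtain ⟨σ, h0, h1⟩ := exists_relabel_cyc hk hnk one_pos (by norm_num : 2 * 1 ≤ 2) hr hB hC h
  have hs := sum_mult_cyc_eq hk hnk one_pos (by norm_num : 2 * 1 ≤ 2) hr hA
    (by rw [hsum]; simp [mul_comm]) σ
  have hm : ∀ B, mult A B = (if B ∈ A 0 then 1 else 0) + if B ∈ A 1 then 1 else 0 := fun B => by
    rw [mult, Finset.card_filter, Fin.sum_univ_two]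
  rw [Finset.sum_range_succ, Finset.sum_range_one, h0, h1, hm, hm] at hs
  have c01 : B ∈ A 0 → C ∉ A 1 := fun hB hC => by simpa using hA.eq_of_not_meets h hB hC
  have c10 : B ∈ A 1 → C ∉ A 0 := fun hB hC => by simpa using hA.eq_of_not_meets h hB hC
  by_cases b0 : B ∈ A 0 <;> by_cases b1 : B ∈ A 1 <;> by_cases c0 : C ∈ A 0 <;>
    by_cases c1 : C ∈ A 1 <;> simp_all

variable {m : ℕ} {A : Fin m → Finset ((i : Fin p) → Finset (Fin (n i)))} {l : Fin p}

lemma isConstantConfig_of_gt (hk : ∀ i, 0 < k i) (hnk : ∀ i, 2 * k i ≤ n i)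
    (hl : ∀ i, n l * k i ≤ k l * n i) (hA : CrossIntersecting (layer n k) A)
    (hm : n l < m * k l) (hsum : ∑ i, (A i).card = m * starMax n k) :
    IsConstantConfig n k A := by
  have hm3 : 2 < m := Nat.lt_of_mul_lt_mul_right ((hnk l).trans_lt hm)
  refine isConstantConfig_of_mult hk hnk hl hA hm3.le hsum fun B hB => ?_
  obtain ⟨C, hC, hBC⟩ := exists_not_meets hnk hB
  have heq : n l * ∑ i, (A i).card = (layer n k).card * max (n l) (m * k l) := by
    rw [hsum, max_eq_right hm.le, mul_left_comm, mul_starMax hk hnk hl]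
    ring
  rcases mult_pair_of_eq hk hnk (hk l) (hnk l) hl hA heq hB hC hBC with h | h
  · omega
  · exact (h.2 hm3).1

variable [NeZero m]

lemma isTrivialConfig_of_lt (hk : ∀ i, 0 < k i) (hnk : ∀ i, 2 * k i ≤ n i)
    (hl : ∀ i, n l * k i ≤ k l * n i) (hA : CrossIntersecting (layer n k) A) (hne : A 0 ≠ ∅)
    (hm : m * k l < n l) (hsum : ∑ i, (A i).card = (layer n k).card) : IsTrivialConfig n k A := by
  rcases (Nat.one_le_iff_ne_zero.2 (NeZero.ne m)).eq_or_lt with rfl | hm1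
  · refine ⟨Finset.eq_of_subset_of_card_le (hA.1 0) ?_, fun i hi => absurd (Subsingleton.elim i 0) hi⟩
    rw [← hsum, Fin.sum_univ_one]
  · have h2 : 2 * k l < n l := (Nat.mul_le_mul_right _ hm1).trans_lt hm
    refine isTrivialConfig_of_mult_eq_one (fun i => two_mul_lt_of_ratio (hk i) (hl i) h2) hA hne ?_
    intro B hB
    obtain ⟨C, hC, hBC⟩ := exists_not_meets hnk hB
    have heq : n l * ∑ i, (A i).card = (layer n k).card * max (n l) (m * k l) := by
      rw [hsum, max_eq_left hm.le, mul_comm]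
    rcases mult_pair_of_eq hk hnk (hk l) (hnk l) hl hA heq hB hC hBC with h | h
    · exact h.2.1
    · omega

lemma trivial_or_constant_or_mixed_of_eq (hk : ∀ i, 0 < k i) (hnk : ∀ i, 2 * k i ≤ n i)
    (hl : ∀ i, n l * k i ≤ k l * n i) (hA : CrossIntersecting (layer n k) A) (hne : A 0 ≠ ∅)
    (hm : m * k l = n l) (hsum : ∑ i, (A i).card = (layer n k).card) :
    IsTrivialConfig n k A ∨ IsConstantConfig n k A ∨
      ∃ h : 1 < m, IsMixedPair n k (A 0) (A ⟨1, h⟩) := by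
  have hm2 : 2 ≤ m := Nat.le_of_mul_le_mul_right (hm ▸ hnk l) (hk l)
  have hsum' : ∑ i, (A i).card = m * starMax n k := by
    refine Nat.eq_of_mul_eq_mul_left (hk l) ?_
    rw [hsum, ← mul_starMax hk hnk hl, ← hm]
    ring
  rcases hm2.eq_or_lt with rfl | hm3
  · right
    by_cases h01 : A 0 = A 1
    · left
      refine isConstantConfig_of_mult hk hnk hl hA le_rfl hsum' fun B _ => ?_
      by_cases hB : B ∈ A 0
      · exact Or.inr (mult_eq_card_iff.2 (Fin.forall_fin_two.2 ⟨hB, h01 ▸ hB⟩))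
      · left
        refine Nat.eq_zero_of_not_pos fun hpos => hB ?_
        obtain ⟨i, hi⟩ := mult_pos_iff.1 hpos
        revert hi
        exact Fin.forall_fin_two (p := fun i => B ∈ A i → B ∈ A 0).2 ⟨id, fun h => h01 ▸ h⟩ i
    · exact Or.inr ⟨one_lt_two, isMixedPair_of_law hk hnk hm.symm (hA.1 0) (hA.1 1) h01
        fun B hB C hC h => mem_iff_notMem_of_sum_eq hk hnk hA hsum hB hC h⟩
  · have h2 : 2 * k l < n l := hm ▸ Nat.mul_lt_mul_of_pos_right hm3 (hk l)
    have hlt : ∀ i, 2 * k i < n i := fun i => two_mul_lt_of_ratio (hk i) (hl i) h2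
    have heq : n l * ∑ i, (A i).card = (layer n k).card * max (n l) (m * k l) := by
      rw [hsum, hm, max_self, mul_comm]
    have pair : ∀ B ∈ layer n k, ∀ C ∈ layer n k, ¬ Meets B C →
        (mult A B = 1 ∧ mult A C = 1) ∨
          (mult A B = 0 ∨ mult A B = m) ∧ (mult A C = 0 ∨ mult A C = m) :=
      fun B hB C hC hBC => (mult_pair_of_eq hk hnk (hk l) (hnk l) hl hA heq hB hC hBC).imp
        (fun h => h.2) fun h => h.2 hm3
    by_cases h1 : ∃ B ∈ layer n k, mult A B = 1
    · obtain ⟨B, hB, hB1⟩ := h1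
      left
      refine isTrivialConfig_of_mult_eq_one hlt hA hne fun Z hZ => ?_
      refine of_two_step hnk (P := fun B => mult A B = 1) ?_ hB hZ
        (fun i hi => absurd hi (hlt i).ne') hB1
      intro C hC D hD E hE hCD hDE hC1
      have h1 := pair C hC D hD hCD
      have h2 := pair D hD E hE hDE
      omega
    · right
      left
      refine isConstantConfig_of_mult hk hnk hl hA hm2 hsum' fun B hB => ?_
      obtain ⟨C, hC, hBC⟩ := exists_not_meets hnk hB
      exact (pair B hB C hC hBC).elim (fun h => absurd ⟨B, hB, h.1⟩ h1) fun h => h.1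

lemma sum_card_of_mixed (hk : ∀ i, 0 < k i) (hl : ∀ i, n l * k i ≤ k l * n i) (hm : m * k l = n l) {h : 1 < m}
    (hmix : IsMixedPair n k (A 0) (A ⟨1, h⟩)) : ∑ i, (A i).card = (layer n k).card := by
  obtain ⟨S, ⟨s, hs⟩, hS, -⟩ := id hmix
  -- a part with ratio two leaves room for two families only
  have hm2 : m = 2 := by
    by_contra hne
    have hm3 : 2 < m := by omega
    have := two_mul_lt_of_ratio (hk s) (hl s) (hm ▸ Nat.mul_lt_mul_of_pos_right hm3 (hk l))
    have := eq_two_mul_of_div_eq hk (hS s hs)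
    omega
  subst hm2
  rw [Fin.sum_univ_two]
  exact hmix.card_add_card hk

end Extremal

end MultiPart

open MultiPart in
theorem theorem1p4 (p : ℕ) [NeZero p] (n k : Fin p → ℕ)
    (hk : ∀ i, 0 < k i) (hnk : ∀ i, 2 * k i ≤ n i)
    (m : ℕ) [NeZero m] (A : Fin m → Finset ((i : Fin p) → Finset (Fin (n i))))
    (hA : MultiPart.CrossIntersecting (MultiPart.layer n k) A) (hne : A 0 ≠ ∅) :
    ((m : ℚ) ≤ MultiPart.minRatio n k →
      ∑ i, (A i).card ≤ (MultiPart.layer n k).card ∧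
      (∑ i, (A i).card = (MultiPart.layer n k).card ↔ MultiPart.IsExtremal n k A)) ∧
    ((m : ℚ) ≥ MultiPart.minRatio n k →
      ∑ i, (A i).card ≤ m * MultiPart.starMax n k ∧
      (∑ i, (A i).card = m * MultiPart.starMax n k ↔ MultiPart.IsExtremal n k A)) := by
  obtain ⟨l, hmin, hl⟩ := exists_minRatio_eq (n := n) hk
  have hkl : (0 : ℚ) < k l := by exact_mod_cast hk l
  have hn : 0 < n l := by have := hk l; have := hnk l; omega
  have hbound := mul_sum_card_le hk hnk (hk l) (hnk l) hl hA
  have hM := mul_starMax hk hnk hl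
  have hlt : (m : ℚ) < minRatio n k ↔ m * k l < n l := by
    rw [hmin, lt_div_iff₀ hkl]; norm_cast
  have hgt : (m : ℚ) > minRatio n k ↔ n l < m * k l := by
    rw [hmin, gt_iff_lt, div_lt_iff₀ hkl]; norm_cast
  have heq : (m : ℚ) = minRatio n k ↔ m * k l = n l := by
    rw [hmin, eq_div_iff hkl.ne']; norm_cast
  have hX : m * k l = n l → (layer n k).card = m * starMax n k := fun h => by
    refine Nat.eq_of_mul_eq_mul_left (hk l) ?_
    rw [← hM, ← h]
    ring
  have hEq : m * k l = n l → (∑ i, (A i).card = (layer n k).card ↔ IsExtremal n k A) := by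
    intro h
    rw [IsExtremal, hlt, hgt, heq]
    constructor
    · exact fun hs => Or.inr (Or.inr
        ⟨h, trivial_or_constant_or_mixed_of_eq hk hnk hl hA hne h hs⟩)
    · rintro (⟨h', -⟩ | ⟨h', -⟩ | ⟨-, ht | hc | ⟨_, hmix⟩⟩)
      · omega
      · omega
      · exact ht.sum_card
      · rw [hX h]
        exact hc.sum_card hk hnk hl
      · exact sum_card_of_mixed hk hl h hmix
  constructor
  · intro h
    have hle : m * k l ≤ n l := by
      rw [hmin, le_div_iff₀ hkl] at h
      exact_mod_cast h
    refine ⟨?_, ?_⟩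
    · rw [max_eq_left hle, mul_comm _ (n l)] at hbound
      exact Nat.le_of_mul_le_mul_left hbound hn
    rcases hle.lt_or_eq with h' | h'
    · rw [IsExtremal, hlt, hgt, heq]
      constructor
      · exact fun hs => Or.inl ⟨h', isTrivialConfig_of_lt hk hnk hl hA hne h' hs⟩
      · rintro (⟨-, ht⟩ | ⟨h'', -⟩ | ⟨h'', -⟩)
        · exact ht.sum_card
        · omega
        · omega
    · exact hEq h'
  · intro h
    have hge : n l ≤ m * k l := by
      rw [hmin, ge_iff_le, div_le_iff₀ hkl] at h
      exact_mod_cast h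
    refine ⟨?_, ?_⟩
    · rw [max_eq_right hge] at hbound
      refine Nat.le_of_mul_le_mul_left (hbound.trans_eq ?_) hn
      rw [mul_left_comm (n l), hM]
      ring
    rcases hge.lt_or_eq with h' | h'
    · rw [IsExtremal, hlt, hgt, heq]
      constructor
      · exact fun hs => Or.inr (Or.inl ⟨h', isConstantConfig_of_gt hk hnk hl hA h' hs⟩)
      · rintro (⟨h'', -⟩ | ⟨-, hc⟩ | ⟨h'', -⟩)
        · omega
        · exact hc.sum_card hk hnk hl
        · omega
    · rw [← hEq h'.symm, hX h'.symm]
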